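/- **Setting.** Let $T_1,T_2$ be free generators of $\mathbb F_2$, $|g|$ the word length of $g$, $X=\{-1,1\}^{\mathbb F_2}$ with the uniform product probability $m$ and the shift action $(gx)^h=x^{g^{-1}h}$, and $X'\subseteq X$ the set of points on which $\mathbb F_2$ acts freely. An arrow *could be directed* from $x$ to the two points $T_1x,T_2x$ if $x^e=1$, and to $T_1^{-1}x,T_2^{-1}x$ if $x^e=-1$ ($e$ the identity of $\mathbb F_2$). Let $g_1,\dots,g_4$ be $T_1T_2^{-1},T_1^{-1}T_2,T_2T_1^{-1},T_2^{-1}T_1$ and $g_5,\dots,g_{16}$ the twelve elements of length four that are products of two of these. An *original colouring* is a Borel colouring $c$ of $X'$ with finitely many colours, each of positive probability, such that $c(g_ix)\ne c(x)$ for all $x\in X'$ and $i\le 16$. The *secondary graph* joins distinct $x,y\in X'$ if there is a $z$ to which arrows could be directed from both $x$ and $y$. A *proper list colouring* of it is a proper colouring $e$ in which $e(x)\in\{c(z_1),c(z_2)\}$ for each $x\in X'$, where $z_1,z_2$ are the two points to which an arrow could be directed from $x$. Let $N$ be odd and $Q\subseteq X$ Borel such that for each $x\in X'\setminus Q$ every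 colour is $c(gx)$ for some $g$ with $|g|$ odd and $|g|\le N$. On two copies of $X$, each of total probability $\tfrac12$, with $\rho$ the identification of the first copy with the second, let $\Gamma=\Gamma(c,N,Q)$ be the graph with the following edges: * $x$ and $y$ in the first copy, $x,y\notin Q$, if they are adjacent in the secondary graph; * $\rho(x)$ and $\rho(gx)$ for $x\in X'$, $|g|$ even, $|g|\le 2N+10$ and $c(gx)\neq c(x)$; * $x$ in the first copy and $\rho(gx)$, for $x\in X'\setminus Q$, $|g|$ odd, $|g|\le N$ and $c(gx)\notin\{c(z_1),c(z_2)\}$, with $z_1,z_2$ the two points to which an arrow could be directed from $x$. The descendants are the measure preserving maps given by the $g\neq e$ with $|g|$ even, $|g|\le 2N+10$, acting on each copy, and by the $g$ with $|g|$ odd, $|g|\le N$, acting and exchanging the two copies. The *proper colouring rule* of $\Gamma$, with the colours of $c$, requires that the colour of a point $v$ differ from the colours of those descendants of $v$ that are adjacent to $v$ in $\Gamma$. A colouring rule (finitely many measure preserving descendants, almost no point being its own descendant, and a correspondence with measurable graph giving the allowed colours) is *paradoxical* if some colouring satisfies it almost everywhere, but for no finitely additive extension of the probability measure, to an algebra of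 sets, for which the descendants are still measure preserving, is there a measurable colouring satisfying the rule almost everywhere. It is *stationary* if the set of allowed colours depends, up to a null set of points, only on the colours of the descendants. **Proposition.** Original colourings with at most $17$ colours exist. For every original colouring $c$ and every $\varepsilon>0$ there are $N$ and $Q$ as above with $m(Q)\le\varepsilon$. For every original colouring $c$ and all $N,Q$ as above with $m(Q)<\tfrac1{512}$: 1. $\Gamma$ has bounded degree, every neighbour of a vertex is one of its descendants, for each descendant the set of vertices at which it is a neighbour is Borel, and the proper colouring rule of $\Gamma$ is not stationary. 2. The proper colouring rule of $\Gamma$, with the colours of $c$, is paradoxical. 3. For a colouring $d$ of the two copies, say that there is an arrow from $x$ to $z$ if one could be directed from $x$ to $z$ and $d(x)=d(\rho(z))$. Let $\mu$ be a finitely additive extension of the probability measure to an algebra of sets that is stable under preimages by the descendants, and let $d$ satisfy the proper colouring rule almost everywhere and be measurable with respect to this algebra. Then, normalising each copy of $X$ to total mass $1$, the weight of the outgoing arrows (counted at their sources, in the first copy) is at least $1-\tfrac1{512}$ and the weight of the incoming arrows (counted at their targets, in the second copy) is at most $\tfrac{31}{32}$; and the two weights are equal if the descendants preserve $\mu$.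 4. There are proper list colourings of the secondary graph, and for each of them, using it on the first copy and $c\circ\rho^{-1}$ on the second copy gives a proper colouring of $\Gamma$ (points off $X'$ have no edges and may be coloured arbitrarily). -/

import Mathlib

open MeasureTheory
open scoped ENNReal

namespace ParadoxicalColouring

/-! ### Colouring rules on a probability space

A rule on `X` with colours in `A` is given by a finite family `desc` of self-maps of `X` (the
descendants of `x` are the points `desc i x`) and by a correspondence `F : X → (ι → A) → Set A`;
`F x b` is the set of colours allowed at `x` when the descendants have the colours `b`. -/

section Rules

variable {X ι A : Type*} [MeasurableSpace X] [MeasurableSpace A]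

/-- `F` is a colouring rule on `(X, m)` with descendants `desc`: there are finitely many
descendants, they are measure preserving, almost no point is a descendant of itself, and the graph
of `F` is measurable in `A × (X × (ι → A))` when `X` carries the completion of its
σ-algebra with respect to `m`. -/
structure IsColouringRule (m : Measure X) (desc : ι → X → X) (F : X → (ι → A) → Set A) :
    Prop where
  finite_desc : Finite ι
  measurePreserving : ∀ i, MeasurePreserving (desc i) m m
  irreflexive : ∀ᵐ x ∂m, ∀ i, desc i x ≠ x
  measurable_graph :
    MeasurableSet {p : A × (NullMeasurableSpace X m × (ι → A)) | p.1 ∈ F p.2.1 p.2.2}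

/-- The rule is stationary: up to a null set, `F x b` depends on `b` only. -/
def IsStationary (m : Measure X) (F : X → (ι → A) → Set A) : Prop :=
  ∃ F₀ : (ι → A) → Set A, ∀ᵐ x ∂m, ∀ b, F x b = F₀ b

/-- The colouring `d` satisfies the rule almost everywhere. -/
def Satisfies (m : Measure X) (desc : ι → X → X) (F : X → (ι → A) → Set A) (d : X → A) : Prop :=
  ∀ᵐ x ∂m, d x ∈ F x (fun i => d (desc i x))

/-- `μ`, on the algebra of sets `𝒜`, is a finitely additive extension of `m`. -/
structure IsFinAddExtension (m : Measure X) (𝒜 : Set (Set X)) (μ : AddContent ℝ≥0∞ 𝒜) :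
    Prop where
  isSetAlgebra : IsSetAlgebra 𝒜
  mem_of_measurableSet : ∀ E, MeasurableSet E → E ∈ 𝒜
  eq_of_measurableSet : ∀ E, MeasurableSet E → μ E = m E

/-- The algebra `𝒜` is stable under preimages by the descendants. -/
def DescMeasurable (desc : ι → X → X) (𝒜 : Set (Set X)) : Prop :=
  ∀ i, ∀ E ∈ 𝒜, desc i ⁻¹' E ∈ 𝒜

/-- The descendants are measure preserving for the finitely additive measure `μ` on `𝒜`. -/
def DescInvariant (desc : ι → X → X) (𝒜 : Set (Set X)) (μ : AddContent ℝ≥0∞ 𝒜) : Prop :=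
  DescMeasurable desc 𝒜 ∧ ∀ i, ∀ E ∈ 𝒜, μ (desc i ⁻¹' E) = μ E

/-- The colouring `d` is measurable with respect to the algebra `𝒜`. -/
def ColouringMeasurable (𝒜 : Set (Set X)) (d : X → A) : Prop :=
  ∀ D : Set A, MeasurableSet D → d ⁻¹' D ∈ 𝒜

/-- A paradoxical colouring rule: some colouring satisfies it almost everywhere, but no colouring
satisfying it almost everywhere is measurable for a finitely additive extension of `m` for which
the descendants are still measure preserving. -/
structure IsParadoxical (m : Measure X) (desc : ι → X → X) (F : X → (ι → A) → Set A) :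
    Prop where
  isColouringRule : IsColouringRule m desc F
  nonContradictory : ∃ d : X → A, Satisfies m desc F d
  not_measurable : ∀ (𝒜 : Set (Set X)) (μ : AddContent ℝ≥0∞ 𝒜),
    IsFinAddExtension m 𝒜 μ → DescInvariant desc 𝒜 μ →
      ∀ d : X → A, Satisfies m desc F d → ¬ ColouringMeasurable 𝒜 d

/-- The rule of proper vertex colouring for the graph `G`: the colour of `x` has to differ from
the colours of those descendants of `x` that are adjacent to `x`. -/
def properRule (G : SimpleGraph X) (desc : ι → X → X) : X → (ι → A) → Set A :=
  fun x b => {a | ∀ i, G.Adj x (desc i x) → a ≠ b i}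

end Rules

/-! ### The shift of the free group on two generators -/

/-- The free group with the two generators `FreeGroup.of 0` and `FreeGroup.of 1`. -/
abbrev F₂ := FreeGroup (Fin 2)

/-- The space `{-1, 1} ^ F₂`, with `true` for `1` and `false` for `-1`. -/
abbrev Space := F₂ → Bool

/-- The uniform probability on a two-point set. -/
noncomputable def coin : Measure Bool := (PMF.uniformOfFintype Bool).toMeasure

/-- The product probability on `{-1, 1} ^ F₂`. -/
noncomputable def productProb : Measure Space := Measure.infinitePi fun _ => coin

/-- The shift action of `F₂`. -/
def shift (g : F₂) (x : Space) : Space := fun h => x (g⁻¹ * h)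

/-- The set of points on which `F₂` acts freely. -/
def freePart : Set Space := {x | ∀ g : F₂, g ≠ 1 → shift g x ≠ x}

/-- `dir i true` is the generator `T i` and `dir i false` is its inverse. -/
def dir (i : Fin 2) (s : Bool) : F₂ := if s then FreeGroup.of i else (FreeGroup.of i)⁻¹

/-- An arrow could be directed from `x` to `z`: `z` is one of the points `T i x` if the coordinate
of `x` at the identity is `1`, and one of the points `T i ⁻¹ x` if it is `-1`. -/
def PotentialArrow (x z : Space) : Prop := ∃ i : Fin 2, z = shift (dir i (x 1)) x

/-! ### The original colouring and the secondary graph -/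

/-- The four elements `T₁ T₂⁻¹`, `T₁⁻¹ T₂`, `T₂ T₁⁻¹`, `T₂⁻¹ T₁`. -/
def shortMoves : Set F₂ := {g | ∃ (i j : Fin 2) (s : Bool), i ≠ j ∧ g = dir i s * dir j (!s)}

/-- The twelve elements of length four that are products of two of the previous ones. -/
def longMoves : Set F₂ := {g | g.norm = 4 ∧ ∃ a ∈ shortMoves, ∃ b ∈ shortMoves, g = a * b}

/-- `c` is an original colouring with `k` colours: a Borel colouring for which `x` and `g x` have
different colours for each of the sixteen elements `g` and each `x` in the free part, and for
which every colour has positive probability. (Values of `c` off the free part play no role.) -/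
structure IsOriginalColouring (k : ℕ) (c : Space → Fin k) : Prop where
  measurable : Measurable c
  ne_of_move : ∀ x ∈ freePart, ∀ g ∈ shortMoves ∪ longMoves, c (shift g x) ≠ c x
  pos : ∀ j, 0 < productProb (freePart ∩ c ⁻¹' {j})

/-- The graph of cliques: distinct points of the free part are adjacent if there is a point to
which arrows could be directed from both of them. -/
def secondaryGraph : SimpleGraph Space where
  Adj x y := x ≠ y ∧ x ∈ freePart ∧ y ∈ freePart ∧ ∃ z, PotentialArrow x z ∧ PotentialArrow y z
  symm := ⟨fun _ _ ⟨h, hx, hy, z, hxz, hyz⟩ => ⟨h.symm, hy, hx, z, hyz, hxz⟩⟩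
  loopless := ⟨fun _ h => h.1 rfl⟩

/-- `e` is a proper list colouring of the secondary graph, the list at `x` consisting of the
original colours of the two points to which an arrow could be directed from `x`. -/
def IsListColouring {k : ℕ} (c e : Space → Fin k) : Prop :=
  (∀ x ∈ freePart, ∃ z, PotentialArrow x z ∧ e x = c z) ∧
    ∀ x y, secondaryGraph.Adj x y → e x ≠ e y

/-- Off `Q`, all colours appear within radius `N` when applying words of odd length. -/
def ColoursAppear {k : ℕ} (c : Space → Fin k) (N : ℕ) (Q : Set Space) : Prop :=
  ∀ x ∈ freePart \ Q, ∀ j, ∃ g : F₂, Odd g.norm ∧ g.norm ≤ N ∧ c (shift g x) = j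

/-! ### The graph on two copies of the space -/

/-- Two copies of the space: `(x, false)` lies in the first and `(x, true)` in the second copy. -/
abbrev TwoCopies := Space × Bool

/-- The probability on the two copies; each of them has probability one half. -/
noncomputable def twoCopyMeasure : Measure TwoCopies := productProb.prod coin

/-- The adjacencies: those of the secondary graph in the first copy, off `Q`; those between
points of the second copy with different original colours that are joined by a word of even length
at most `2 * N + 10`; and those between a point `x` of the first copy, off `Q`, and a point of the
second copy that is reached from `x` by a word of odd length at most `N` and whose original colour
is not one of the two colours in the list of `x`. -/
inductive Link {k : ℕ} (c : Space → Fin k) (N : ℕ) (Q : Set Space) : TwoCopies → TwoCopies → Prop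
  | clique {x y : Space} : x ∉ Q → y ∉ Q → secondaryGraph.Adj x y →
      Link c N Q (x, false) (y, false)
  | second {x : Space} {g : F₂} : x ∈ freePart → Even g.norm → g.norm ≤ 2 * N + 10 →
      c (shift g x) ≠ c x → Link c N Q (x, true) (shift g x, true)
  | cross {x : Space} {g : F₂} : x ∈ freePart → x ∉ Q → Odd g.norm → g.norm ≤ N →
      (∀ z, PotentialArrow x z → c (shift g x) ≠ c z) →
      Link c N Q (x, false) (shift g x, true)

/-- The graph on the two copies. -/
def doubleGraph {k : ℕ} (c : Space → Fin k) (N : ℕ) (Q : Set Space) : SimpleGraph TwoCopies :=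
  SimpleGraph.fromRel (Link c N Q)

/-- The group elements that define the descendants. -/
abbrev Move (N : ℕ) :=
  {g : F₂ // g ≠ 1 ∧ ((Even g.norm ∧ g.norm ≤ 2 * N + 10) ∨ (Odd g.norm ∧ g.norm ≤ N))}

/-- The descendants: an element of even length acts on each copy, an element of odd length acts
and exchanges the two copies. -/
def desc (N : ℕ) (g : Move N) (v : TwoCopies) : TwoCopies :=
  (shift g.1 v.1, if Even g.1.norm then v.2 else !v.2)

/-! ### Arrows defined by a colouring of the two copies -/

/-- The colouring `d` directs an arrow from `x` to `z`: an arrow could be directed from `x` to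
`z`, and `x` in the first copy has the colour of `z` in the second copy. -/
def Arrow {k : ℕ} (d : TwoCopies → Fin k) (x z : Space) : Prop :=
  PotentialArrow x z ∧ d (x, false) = d (z, true)

/-- The weight of the outgoing arrows, counted at their sources. The factor `2` normalises a copy
of the space to total mass one. -/
noncomputable def outWeight {k : ℕ} (μ : Set TwoCopies → ℝ≥0∞) (d : TwoCopies → Fin k) : ℝ≥0∞ :=
  2 * ∑ i : Fin 2, ∑ s : Bool, μ {v | v.2 = false ∧ Arrow d v.1 (shift (dir i s) v.1)}

/-- The weight of the incoming arrows, counted at their targets. -/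
noncomputable def inWeight {k : ℕ} (μ : Set TwoCopies → ℝ≥0∞) (d : TwoCopies → Fin k) : ℝ≥0∞ :=
  2 * ∑ i : Fin 2, ∑ s : Bool, μ {v | v.2 = true ∧ Arrow d (shift (dir i s)⁻¹ v.1) v.1}

end ParadoxicalColouring

/-!
The contradiction behind the paradox is a count of arrows. Let `d` satisfy the proper colouring
rule of the graph on the two copies.

*Outgoing arrows.* For `x ∉ Q` all original colours appear at the points `g x` with `g` of odd
length at most `N`. Two such points with different original colours are adjacent in the second
copy, so there `d` is a permutation of the original colouring. The edges between the copies forbid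
`x` all of the permuted colours except those of the two points to which an arrow could be directed
from `x`; hence `x` directs at least one arrow (`exists_arrow`, `le_outWeight`).

*Incoming arrows.* The points off `Q` from which an arrow could be directed to `z` form a clique of
the secondary graph, so that at most one of them directs an arrow to `z`
(`arrow_source_unique`), and with probability `1/16` there is no such point at all
(`productProb_possibleTargets`, `inWeight_le`). The sources in `Q` add at most `4/512`.

The letters of the free group, which carry sources to targets, are descendants. So the two weights
agree for a finitely additive measure that is invariant under the descendants
(`outWeight_eq_inWeight`), although one is at least `1 - 1/512` and the other at most `31/32`.

A colouring that satisfies the rule exists by the axiom of choice. A root is chosen in each orbit of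
the free part, which is a tree, and from each point an arrow is directed away from the root. No
point is hit twice (`exists_injective_arrows`), the targets of adjacent points differ by one of the
sixteen moves, and so the original colours of the targets form a proper list colouring
(`IsOriginalColouring.exists_isListColouring`).

Original colourings are obtained greedily along a countable cover of the free part by Borel sets
disjoint from their images under the moves; sixteen neighbours leave one of seventeen colours free
(`IsPartialColouring.exists_extension`). All colours appear near most points because the words of
even length act ergodically on the Bernoulli shift (`productProb_eq_zero_or_one`).
-/

namespace ParadoxicalColouring


/-! ### Words of the free group -/

lemma norm_dir (i : Fin 2) (s : Bool) : (dir i s).norm = 1 := by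
  revert i s; decide

lemma dir_not (i : Fin 2) (s : Bool) : dir i (!s) = (dir i s)⁻¹ := by
  cases s <;> simp [dir]

lemma dir_injective {i j : Fin 2} {s t : Bool} (h : dir i s = dir j t) : i = j ∧ s = t := by
  revert i j s t; decide

/-- Since reduction removes letters in pairs, the parity of the length is additive. -/
lemma even_norm_mul (g h : F₂) : Even (g * h).norm ↔ (Even g.norm ↔ Even h.norm) := by
  let φ : F₂ →* Multiplicative (ZMod 2) := FreeGroup.lift fun _ => Multiplicative.ofAdd 1
  have hmk : ∀ L : List (Fin 2 × Bool),
      φ (FreeGroup.mk L) = Multiplicative.ofAdd (L.length : ZMod 2) := by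
    intro L
    induction L with
    | nil => rfl
    | cons a L ih =>
      have : FreeGroup.mk (a :: L) = FreeGroup.mk [a] * FreeGroup.mk L := by simp
      rw [this, map_mul, ih]
      obtain ⟨i, s⟩ := a
      have h1 : φ (FreeGroup.mk [(i, s)]) = Multiplicative.ofAdd 1 := by
        cases s
        · simp [φ]; rfl
        · simp [φ]
      rw [h1, ← ofAdd_add, List.length_cons, Nat.cast_add, add_comm]
      simp
  have key : ∀ g : F₂, φ g = Multiplicative.ofAdd (g.norm : ZMod 2) := by
    intro g
    rw [FreeGroup.norm, ← hmk, FreeGroup.mk_toWord]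
  have e : ((g * h).norm : ZMod 2) = g.norm + h.norm := by
    apply Multiplicative.ofAdd.injective
    rw [ofAdd_add, ← key, ← key, ← key, map_mul]
  rw [← Nat.even_add, ← ZMod.natCast_eq_zero_iff_even, ← ZMod.natCast_eq_zero_iff_even, e,
    Nat.cast_add]

lemma finite_norm_le (n : ℕ) : {g : F₂ | g.norm ≤ n}.Finite :=
  ((List.finite_length_le (Fin 2 × Bool) n).preimage
    FreeGroup.toWord_injective.injOn).subset fun _ hg => hg

/-- Multiplication by a letter either lengthens the word, or removes its first letter. -/
lemma toWord_dir_mul (i : Fin 2) (s : Bool) (g : F₂) :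
    (dir i s * g).toWord = (i, s) :: g.toWord ∨ g.toWord.head? = some (i, !s) := by
  have hd : (dir i s).toWord = [(i, s)] := by revert i s; decide
  rw [FreeGroup.toWord_mul, hd, List.singleton_append, FreeGroup.reduce.cons,
    FreeGroup.reduce_toWord]
  rcases h : g.toWord with _ | ⟨⟨j, t⟩, L⟩
  · simp
  · by_cases h' : i = j ∧ s = !t
    · right
      simp [h'.1, h'.2]
    · left
      simp only [h']
      simp

lemma exists_toWord_dir_mul (s : Bool) (g : F₂) :
    ∃ i, (dir i s * g).toWord = (i, s) :: g.toWord := by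
  rcases toWord_dir_mul 0 s g with h | h
  · exact ⟨0, h⟩
  rcases toWord_dir_mul 1 s g with h' | h'
  · exact ⟨1, h'⟩
  simp [h] at h'

lemma shortMoves_norm {g : F₂} (hg : g ∈ shortMoves) : g.norm = 2 := by
  obtain ⟨i, j, s, hij, rfl⟩ := hg
  revert i j s; decide

lemma shortMoves_mul {a b : F₂} (ha : a ∈ shortMoves) (hb : b ∈ shortMoves) (hab : a * b ≠ 1) :
    a * b ∈ longMoves := by
  refine ⟨?_, a, ha, b, hb, rfl⟩
  obtain ⟨i, j, s, hij, rfl⟩ := ha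
  obtain ⟨k, l, t, hkl, rfl⟩ := hb
  revert i j s k l t; decide

lemma inv_mem_shortMoves {g : F₂} (hg : g ∈ shortMoves) : g⁻¹ ∈ shortMoves := by
  obtain ⟨i, j, s, hij, rfl⟩ := hg
  refine ⟨j, i, s, hij.symm, ?_⟩
  rw [mul_inv_rev, ← dir_not, ← dir_not, Bool.not_not]

lemma dir_mul_dir_mem_shortMoves {i j : Fin 2} {s t : Bool} (hst : t = !s) (hij : i ≠ j) :
    dir i s * dir j t ∈ shortMoves := ⟨i, j, s, hij, by rw [hst]⟩

/-! ### The shift action -/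

@[simp] lemma shift_one (x : Space) : shift 1 x = x := by
  funext h; simp [shift]

lemma shift_mul (g h : F₂) (x : Space) : shift (g * h) x = shift g (shift h x) := by
  funext k; simp [shift, mul_assoc]

@[simp] lemma shift_inv_shift (g : F₂) (x : Space) : shift g⁻¹ (shift g x) = x := by
  rw [← shift_mul, inv_mul_cancel, shift_one]

@[simp] lemma shift_shift_inv (g : F₂) (x : Space) : shift g (shift g⁻¹ x) = x := by
  rw [← shift_mul, mul_inv_cancel, shift_one]

lemma shift_apply_one (g : F₂) (x : Space) : shift g x 1 = x g⁻¹ := by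
  simp [shift]

lemma shift_inj_of_mem_freePart {x : Space} (hx : x ∈ freePart) {g h : F₂} :
    shift g x = shift h x ↔ g = h := by
  refine ⟨fun e => ?_, fun e => e ▸ rfl⟩
  by_contra hne
  refine hx (h⁻¹ * g) (fun h' => hne (inv_mul_eq_one.1 h').symm) ?_
  rw [shift_mul, e, shift_inv_shift]

lemma shift_mem_freePart_iff {x : Space} (g : F₂) : shift g x ∈ freePart ↔ x ∈ freePart := by
  have key : ∀ (g : F₂) (x : Space), x ∈ freePart → shift g x ∈ freePart := by
    intro g x hx h hh e
    rw [← shift_mul, shift_inj_of_mem_freePart hx] at e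
    exact hh (by simpa using e)
  exact ⟨fun h => by simpa using key g⁻¹ _ h, key g x⟩

@[fun_prop]
lemma measurable_shift (g : F₂) : Measurable (shift g) :=
  measurable_pi_lambda _ fun _ => measurable_pi_apply _

instance : IsProbabilityMeasure coin := by
  unfold coin; infer_instance

instance : IsProbabilityMeasure productProb := by
  unfold productProb; infer_instance

instance : IsProbabilityMeasure twoCopyMeasure := by
  unfold twoCopyMeasure; infer_instance

lemma measurePreserving_shift (g : F₂) : MeasurePreserving (shift g) productProb productProb :=
  ⟨measurable_shift g, Measure.map_infinitePi_infinitePi_of_inj (P := fun _ : F₂ => coin)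
    (mul_right_injective g⁻¹)⟩

@[simp] lemma coin_singleton (b : Bool) : coin {b} = 2⁻¹ := by
  rw [coin, PMF.toMeasure_apply_singleton _ _ (measurableSet_singleton b)]
  simp [PMF.uniformOfFintype_apply]

lemma productProb_cylinder (S : Finset F₂) (v : F₂ → Bool) :
    productProb {x | ∀ h ∈ S, x h = v h} = 2⁻¹ ^ S.card := by
  have : {x : Space | ∀ h ∈ S, x h = v h} = (S : Set F₂).pi fun h => {v h} := by
    ext x; simp [Set.mem_pi]
  rw [this, productProb, Measure.infinitePi_pi _ fun _ _ => measurableSet_singleton _]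
  simp

lemma measurableSet_cylinder (S : Finset F₂) (v : F₂ → Bool) :
    MeasurableSet {x : Space | ∀ h ∈ S, x h = v h} := by
  have : {x : Space | ∀ h ∈ S, x h = v h} = (S : Set F₂).pi fun h => {v h} := by
    ext x; simp [Set.mem_pi]
  rw [this]
  exact MeasurableSet.pi S.countable_toSet fun _ _ => measurableSet_singleton _

lemma measurableSet_fixed (g : F₂) : MeasurableSet {x : Space | shift g x = x} :=
  measurableSet_eq_fun (measurable_shift g) measurable_id

lemma measurableSet_freePart : MeasurableSet freePart := by
  have : freePart = ⋂ g : F₂, ⋂ _ : g ≠ 1, {x | shift g x = x}ᶜ := by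
    ext x; simp [freePart]
  rw [this]
  exact MeasurableSet.iInter fun g => MeasurableSet.iInter fun _ => (measurableSet_fixed g).compl

/-- A point fixed by `g` is constant on the powers of `g`, which are infinitely many. -/
lemma productProb_fixed {g : F₂} (hg : g ≠ 1) : productProb {x | shift g x = x} = 0 := by
  have hinj : Function.Injective fun n : ℕ => g ^ n :=
    injective_pow_iff_not_isOfFinOrder.2 (not_isOfFinOrder_of_isMulTorsionFree hg)
  have hpow : ∀ x : Space, shift g x = x → ∀ n : ℕ, x (g ^ n) = x 1 := by
    intro x hx n
    induction n with
    | zero => simp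
    | succ n ih =>
      rw [← ih]
      conv_lhs => rw [← hx]
      simp [shift, pow_succ']
  have hle : ∀ n : ℕ, productProb {x | shift g x = x} ≤ 2 * 2⁻¹ ^ n := by
    intro n
    let S : Finset F₂ := (Finset.range n).image fun m => g ^ m
    have hS : S.card = n := by
      rw [Finset.card_image_of_injective _ hinj, Finset.card_range]
    calc productProb {x | shift g x = x}
        ≤ productProb ({x | ∀ h ∈ S, x h = true} ∪ {x | ∀ h ∈ S, x h = false}) := by
          refine measure_mono fun x hx => ?_
          rcases hb : x 1 with _ | _
          · right
            intro h hh
            obtain ⟨m, -, rfl⟩ := Finset.mem_image.1 hh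
            rw [hpow x hx, hb]
          · left
            intro h hh
            obtain ⟨m, -, rfl⟩ := Finset.mem_image.1 hh
            rw [hpow x hx, hb]
      _ ≤ _ := measure_union_le _ _
      _ = 2 * 2⁻¹ ^ n := by
          rw [productProb_cylinder S fun _ => true, productProb_cylinder S fun _ => false, hS,
            two_mul]
  have hlim : Filter.Tendsto (fun n : ℕ => 2 * (2⁻¹ : ℝ≥0∞) ^ n) Filter.atTop (nhds (2 * 0)) :=
    ENNReal.Tendsto.const_mul (ENNReal.tendsto_pow_atTop_nhds_zero_of_lt_one (by simp))
      (Or.inr (by simp))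
  rw [mul_zero] at hlim
  exact le_antisymm (ge_of_tendsto' hlim hle) zero_le

lemma ae_mem_freePart : ∀ᵐ x ∂productProb, x ∈ freePart := by
  have : ∀ᵐ x ∂productProb, ∀ g : F₂, g ≠ 1 → shift g x ≠ x := by
    rw [ae_all_iff]
    intro g
    by_cases hg : g = 1
    · simp [hg]
    · filter_upwards [measure_eq_zero_iff_ae_notMem.1 (productProb_fixed hg)] with x hx _ using hx
  exact this

lemma potentialArrow_shift_dir_iff {x : Space} (hx : x ∈ freePart) (i : Fin 2) (s : Bool) :
    PotentialArrow x (shift (dir i s) x) ↔ x 1 = s := by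
  constructor
  · rintro ⟨j, hj⟩
    rw [shift_inj_of_mem_freePart hx] at hj
    exact (dir_injective hj).2.symm
  · rintro rfl
    exact ⟨i, rfl⟩


/-! ### Existence of original colourings -/

/-- The sixteen elements of `shortMoves ∪ longMoves`, as a finite set whose cardinality can be
computed. -/
def moves : Finset F₂ :=
  let S : Finset F₂ := Finset.univ.image fun p : Fin 2 × Bool => dir p.1 p.2 * dir (p.1 + 1) (!p.2)
  S ∪ {g ∈ (S ×ˢ S).image fun p => p.1 * p.2 | g.norm = 4}

set_option maxRecDepth 100000 in
lemma card_moves_le : moves.card ≤ 16 := by decide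

lemma mem_moves_iff {g : F₂} : g ∈ moves ↔ g ∈ shortMoves ∪ longMoves := by
  have hS : ∀ g : F₂, g ∈ Finset.univ.image
      (fun p : Fin 2 × Bool => dir p.1 p.2 * dir (p.1 + 1) (!p.2)) ↔ g ∈ shortMoves := by
    intro g
    simp only [Finset.mem_image, Finset.mem_univ, true_and, shortMoves, Set.mem_ofPred_eq,
      Prod.exists]
    constructor
    · rintro ⟨i, s, rfl⟩
      exact ⟨i, i + 1, s, by revert i; decide, rfl⟩
    · rintro ⟨i, j, s, hij, rfl⟩
      have : j = i + 1 := by revert i j; decide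
      exact ⟨i, s, by rw [this]⟩
  simp only [moves, Finset.mem_union, Finset.mem_filter,
    Finset.mem_image (f := fun p : F₂ × F₂ => _),
    Finset.mem_product, hS, Prod.exists, Set.mem_union, longMoves, Set.mem_ofPred_eq]
  refine or_congr_right ⟨?_, ?_⟩
  · rintro ⟨⟨a, b, ⟨ha, hb⟩, rfl⟩, h⟩
    exact ⟨h, a, ha, b, hb, rfl⟩
  · rintro ⟨h, a, ha, b, hb, rfl⟩
    exact ⟨⟨a, b, ⟨ha, hb⟩, rfl⟩, h⟩

lemma even_norm_of_mem_moves {g : F₂} (hg : g ∈ moves) : Even g.norm := by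
  rcases mem_moves_iff.1 hg with h | h
  · rw [shortMoves_norm h]; decide
  · rw [h.1]; decide

lemma one_notMem_moves : (1 : F₂) ∉ moves := by
  intro h
  rcases mem_moves_iff.1 h with h | h
  · simpa using shortMoves_norm h
  · simpa using h.1

lemma inv_mem_moves {g : F₂} (hg : g ∈ moves) : g⁻¹ ∈ moves := by
  rw [mem_moves_iff] at hg ⊢
  rcases hg with h | ⟨h, a, ha, b, hb, rfl⟩
  · exact Or.inl (inv_mem_shortMoves h)
  · exact Or.inr ⟨by rw [FreeGroup.norm_inv_eq, h], b⁻¹, inv_mem_shortMoves hb, a⁻¹,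
      inv_mem_shortMoves ha, mul_inv_rev _ _⟩

/-- The free part is covered by countably many Borel sets none of which meets its images under the
moves: if `g` does not fix `x`, then some coordinate tells `x` from `g x`, and the sets are given
by such coordinates and their values for all moves `g`. -/
lemma exists_cover_of_freePart : ∃ B : ℕ → Set Space, (∀ n, MeasurableSet (B n)) ∧
    (∀ n, ∀ x ∈ B n, ∀ g ∈ moves, shift g x ∉ B n) ∧ freePart ⊆ ⋃ n, B n := by
  let D : (moves → F₂ × Bool) → Set Space := fun w =>
    {x | ∀ g : moves, x (w g).1 = (w g).2 ∧ x (g.1⁻¹ * (w g).1) ≠ (w g).2}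
  obtain ⟨u, hu⟩ := exists_surjective_nat (moves → F₂ × Bool)
  refine ⟨fun n => D (u n), fun n => ?_, fun n x hx g hg hgx => ?_, fun x hx => ?_⟩
  · change MeasurableSet (D (u n))
    have : D (u n) = ⋂ g : moves, ({x : Space | x (u n g).1 = (u n g).2} ∩
        {x : Space | x (g.1⁻¹ * (u n g).1) = (u n g).2}ᶜ) := by
      ext x; simp [D]
    rw [this]
    refine MeasurableSet.iInter fun g => ?_
    exact (measurable_pi_apply _ (measurableSet_singleton _)).inter
      (measurable_pi_apply _ (measurableSet_singleton _)).compl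
  · exact (hx ⟨g, hg⟩).2 (hgx ⟨g, hg⟩).1
  · have : ∀ g : moves, ∃ h : F₂, x (g.1⁻¹ * h) ≠ x h := by
      intro g
      by_contra! hcon
      exact hx g.1 (fun h => one_notMem_moves (h ▸ g.2)) (funext hcon)
    choose h hh using this
    obtain ⟨n, hn⟩ := hu fun g => (h g, x (h g))
    refine Set.mem_iUnion.2 ⟨n, fun g => ?_⟩
    rw [hn]
    exact ⟨rfl, hh g⟩

section Greedy

instance : MeasurableSpace (Option (Fin 17)) := ⊤

instance : DiscreteMeasurableSpace (Option (Fin 17)) := ⟨fun _ => trivial⟩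

/-- A partial colouring that is proper for the moves; `none` stands for uncoloured points. -/
structure IsPartialColouring (c : Space → Option (Fin 17)) : Prop where
  measurable : Measurable c
  ne_of_move : ∀ x, ∀ g ∈ moves, ∀ a, c x = some a → c (shift g x) ≠ some a

/-- There are more colours than neighbours, hence a free colour. -/
lemma exists_free_colour (b : moves → Option (Fin 17)) : ∃ a : Fin 17, ∀ g, b g ≠ some a := by
  by_contra! hcon
  choose g hg using hcon
  have hinj : Function.Injective g := fun a a' h => by
    have := hg a
    rw [h, hg a'] at this
    exact (Option.some.inj this).symm
  have h := Fintype.card_le_of_injective g hinj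
  rw [Fintype.card_fin, Fintype.card_coe] at h
  have := card_moves_le
  omega

/-- A colour that is not used by the neighbours. -/
noncomputable def freeColour (b : moves → Option (Fin 17)) : Fin 17 := (exists_free_colour b).choose

lemma freeColour_spec (b : moves → Option (Fin 17)) (g : moves) : b g ≠ some (freeColour b) :=
  (exists_free_colour b).choose_spec g

open Classical in
/-- One greedy step: the uncoloured points of `B` get a colour not used by their neighbours. -/
noncomputable def greedyStep (B : Set Space) (c : Space → Option (Fin 17)) (x : Space) :
    Option (Fin 17) :=
  if c x = none ∧ x ∈ B then some (freeColour fun g => c (shift g.1 x)) else c x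

lemma IsPartialColouring.greedyStep {B : Set Space} (hB : MeasurableSet B)
    (hind : ∀ x ∈ B, ∀ g ∈ moves, shift g x ∉ B) {c : Space → Option (Fin 17)}
    (hc : IsPartialColouring c) : IsPartialColouring (greedyStep B c) := by
  constructor
  · have hm := hc.measurable
    refine Measurable.ite ((hm (measurableSet_singleton none)).inter hB) ?_ hm
    have h1 : Measurable fun (x : Space) (g : moves) => c (shift g.1 x) := by fun_prop
    exact (measurable_of_countable fun b : moves → Option (Fin 17) => some (freeColour b)).comp h1
  · intro x g hg a hx hgx
    have hinv : shift g⁻¹ (shift g x) = x := shift_inv_shift g x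
    unfold ParadoxicalColouring.greedyStep at hx hgx
    split_ifs at hx hgx with h1 h2 h2
    · exact hind x h1.2 g hg h2.2
    · have := freeColour_spec (fun g => c (shift g.1 x)) ⟨g, hg⟩
      rw [Option.some.inj hx] at this
      exact this hgx
    · have := freeColour_spec (fun h => c (shift h.1 (shift g x))) ⟨g⁻¹, inv_mem_moves hg⟩
      rw [Option.some.inj hgx] at this
      exact this (by simpa only [hinv] using hx)
    · exact hc.ne_of_move x g hg a hx hgx

/-- The greedy extension of `c₀` along a sequence of sets. -/
noncomputable def greedySeq (B : ℕ → Set Space) (c₀ : Space → Option (Fin 17)) :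
    ℕ → Space → Option (Fin 17)
  | 0 => c₀
  | n + 1 => greedyStep (B n) (greedySeq B c₀ n)

/-- A proper Borel partial colouring extends to a Borel colouring proper on the free part. -/
lemma IsPartialColouring.exists_extension {c₀ : Space → Option (Fin 17)}
    (h₀ : IsPartialColouring c₀) : ∃ c : Space → Fin 17, Measurable c ∧
      (∀ x ∈ freePart, ∀ g ∈ moves, c (shift g x) ≠ c x) ∧ ∀ x a, c₀ x = some a → c x = a := by
  classical
  obtain ⟨B, hBm, hBi, hBc⟩ := exists_cover_of_freePart
  let C : ℕ → Space → Option (Fin 17) := greedySeq B c₀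
  have hC : ∀ n, IsPartialColouring (C n) := by
    intro n
    induction n with
    | zero => exact h₀
    | succ n ih => exact ih.greedyStep (hBm n) (hBi n)
  have hsucc : ∀ n x a, C n x = some a → C (n + 1) x = some a := by
    intro n x a h
    change ParadoxicalColouring.greedyStep (B n) (C n) x = some a
    simp [ParadoxicalColouring.greedyStep, h]
  have hmono : ∀ n m x a, n ≤ m → C n x = some a → C m x = some a := by
    intro n m x a hnm h
    induction m, hnm using Nat.le_induction with
    | base => exact h
    | succ m _ ih => exact hsucc m x a ih
  have hex : ∀ x ∈ freePart, ∃ n a, C n x = some a := by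
    intro x hx
    obtain ⟨n, hn⟩ := Set.mem_iUnion.1 (hBc hx)
    refine ⟨n + 1, ?_⟩
    rw [← Option.ne_none_iff_exists']
    change ParadoxicalColouring.greedyStep (B n) (C n) x ≠ none
    by_cases h : C n x = none <;> simp [ParadoxicalColouring.greedyStep, h, hn]
  let c : Space → Fin 17 := fun x => if h : ∃ a, ∃ n, C n x = some a then h.choose else 0
  have hc : ∀ n x a, C n x = some a → c x = a := by
    intro n x a h
    have h' : ∃ a, ∃ n, C n x = some a := ⟨a, n, h⟩
    obtain ⟨m, hm⟩ := h'.choose_spec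
    simp only [c, dif_pos h']
    have e1 := hmono n (max n m) x a (le_max_left _ _) h
    rw [hmono m (max n m) x _ (le_max_right _ _) hm] at e1
    exact Option.some.inj e1
  refine ⟨c, ?_, ?_, fun x a h => hc 0 x a h⟩
  · have hlim : Filter.Tendsto (fun n x => (C n x).getD 0) Filter.atTop (nhds c) := by
      refine tendsto_pi_nhds.2 fun x => tendsto_nhds_of_eventually_eq ?_
      by_cases h : ∃ a, ∃ n, C n x = some a
      · obtain ⟨a, n, ha⟩ := h
        filter_upwards [Filter.eventually_ge_atTop n] with m hm
        rw [hmono n m x a hm ha, hc n x a ha, Option.getD_some]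
      · refine Filter.Eventually.of_forall fun n => ?_
        have hn : C n x = none := by
          by_contra hne
          obtain ⟨a, ha⟩ := Option.ne_none_iff_exists'.1 hne
          exact h ⟨a, n, ha⟩
        simp only [c, dif_neg h, hn, Option.getD_none]
    exact measurable_of_tendsto_metrizable
      (fun n => (measurable_of_countable fun o : Option (Fin 17) => o.getD 0).comp
        (hC n).measurable) hlim
  · intro x hx g hg h
    obtain ⟨n, a, ha⟩ := hex x hx
    obtain ⟨m, b, hb⟩ := hex (shift g x) ((shift_mem_freePart_iff g).2 hx)
    have e1 := hmono n (max n m) x a (le_max_left _ _) ha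
    have e2 := hmono m (max n m) _ b (le_max_right _ _) hb
    rw [hc n x a ha, hc m _ b hb] at h
    exact (hC _).ne_of_move x g hg a e1 (h ▸ e2)

end Greedy

/-- The colour given to the points of the initial set: the number of `true` among sixteen
coordinates that do not matter for membership in that set. -/
def initialColour (x : Space) : Fin 17 :=
  ⟨({n : Fin 16 | x (FreeGroup.of 0 ^ (2 * n.1 + 1)) = true} : Finset (Fin 16)).card,
    Nat.lt_succ_of_le ((Finset.card_le_univ _).trans (by simp))⟩

lemma measurable_initialColour : Measurable initialColour := by
  have h1 : Measurable fun (x : Space) (n : Fin 16) => x (FreeGroup.of 0 ^ (2 * n.1 + 1)) :=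
    measurable_pi_lambda _ fun _ => measurable_pi_apply _
  exact (measurable_of_countable fun b : Fin 16 → Bool =>
    (⟨({n : Fin 16 | b n = true} : Finset (Fin 16)).card,
    Nat.lt_succ_of_le ((Finset.card_le_univ _).trans (by simp))⟩ : Fin 17)).comp h1

/-- The greedy colouring is started from a partial colouring by seventeen sets of positive
probability, so that all colours have positive probability. -/
lemma exists_isOriginalColouring : ∃ c : Space → Fin 17, IsOriginalColouring 17 c := by
  classical
  let A : Set Space := {x | x 1 = true ∧ ∀ g ∈ moves, x g = false}
  have hA : MeasurableSet A := by
    have : A = {x : Space | x 1 = true} ∩ {x | ∀ g ∈ moves, x g = false} := rfl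
    rw [this]
    exact (measurable_pi_apply _ (measurableSet_singleton _)).inter
      (measurableSet_cylinder moves fun _ => false)
  let c₀ : Space → Option (Fin 17) := fun x => if x ∈ A then some (initialColour x) else none
  have h₀ : IsPartialColouring c₀ := by
    constructor
    · exact Measurable.ite hA ((measurable_of_countable some).comp measurable_initialColour)
        measurable_const
    · intro x g hg a hx hgx
      have h1 : x ∈ A := by by_contra h; simp [c₀, h] at hx
      have h2 : shift g x ∈ A := by by_contra h; simp [c₀, h] at hgx
      have h3 := h2.1
      rw [shift_apply_one, h1.2 _ (inv_mem_moves hg)] at h3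
      exact Bool.false_ne_true h3
  obtain ⟨c, hcm, hcp, hce⟩ := h₀.exists_extension
  refine ⟨c, hcm, fun x hx g hg => hcp x hx g (mem_moves_iff.2 hg), fun j => ?_⟩
  let t : ℕ → F₂ := fun n => FreeGroup.of 0 ^ (2 * n + 1)
  have ht : ∀ n, (t n).norm = 2 * n + 1 := fun n => FreeGroup.norm_of_pow _ _
  have htm : ∀ n, t n ∉ moves := fun n h => by
    have := even_norm_of_mem_moves h
    rw [ht] at this
    exact absurd this (by simp)
  have htinj : ∀ n m, t n = t m → n = m := fun n m h => by
    have := ht n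
    rw [h, ht] at this
    omega
  let v : F₂ → Bool := fun h => decide (h = 1 ∨ ∃ n < j.1, h = t n)
  let S : Finset F₂ := {1} ∪ moves ∪ (Finset.range 16).image t
  have hsub : {x : Space | ∀ h ∈ S, x h = v h} ⊆ c ⁻¹' {j} := by
    intro x hx
    have hxA : x ∈ A := by
      refine ⟨by rw [hx 1 (by simp [S])]; simp [v], fun g hg => ?_⟩
      rw [hx g (by simp [S, hg])]
      simp only [v, decide_eq_false_iff_not, not_or, not_exists, not_and]
      exact ⟨fun h => one_notMem_moves (h ▸ hg), fun n _ h => htm n (h ▸ hg)⟩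
    have hxt : ∀ n < 16, x (t n) = true ↔ n < j.1 := by
      intro n hn
      rw [hx (t n) (by
        simp only [S, Finset.mem_union, Finset.mem_image, Finset.mem_range]
        exact Or.inr ⟨n, hn, rfl⟩)]
      simp only [v, decide_eq_true_eq]
      constructor
      · rintro (h | ⟨m, hm, h⟩)
        · have := ht n
          rw [h, FreeGroup.norm_one] at this
          omega
        · rwa [htinj _ _ h]
      · exact fun h => Or.inr ⟨n, h, rfl⟩
    refine hce x j ?_
    simp only [c₀, hxA, if_true, initialColour]
    congr 1
    apply Fin.ext
    have hcard : ∀ n ∈ (Finset.univ : Finset (Fin 16)), x (t n.1) = true ↔ n.1 < j.1 :=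
      fun n _ => hxt n.1 n.2
    refine (congrArg Finset.card (Finset.filter_congr hcard)).trans ?_
    rw [Fin.card_filter_val_lt]
    omega
  have hpos : 0 < productProb (c ⁻¹' {j}) := by
    refine lt_of_lt_of_le ?_ (measure_mono hsub)
    rw [productProb_cylinder]
    exact ENNReal.pow_pos (by simp) _
  have : productProb (freePart ∩ c ⁻¹' {j}) = productProb (c ⁻¹' {j}) := by
    refine measure_congr ?_
    filter_upwards [ae_mem_freePart] with x hx
    exact propext ⟨fun h => h.2, fun h => ⟨hx, h⟩⟩
  rwa [this]


/-! ### Ergodicity of the words of even length -/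

/-- A set of coordinates can be moved off itself by a word of even length. -/
lemma exists_even_disjoint_image (S : Finset F₂) :
    ∃ g : F₂, Even g.norm ∧ Disjoint S (S.image fun h => g⁻¹ * h) := by
  classical
  let u : ℕ → F₂ := fun n => FreeGroup.of 0 ^ (2 * n)
  have hu : Function.Injective u := by
    intro n m h
    have h' := congrArg FreeGroup.norm h
    simp only [u, FreeGroup.norm_of_pow] at h'
    omega
  obtain ⟨n, hn⟩ : ∃ n, u n ∉ (S ×ˢ S).image fun p => p.1 * p.2⁻¹ :=
    Set.Infinite.exists_notMem_finset (Set.infinite_range_of_injective hu) _ |>.elim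
      fun a ha => by
        obtain ⟨⟨n, rfl⟩, h⟩ := ha
        exact ⟨n, h⟩
  refine ⟨u n, by simp [u, FreeGroup.norm_of_pow], ?_⟩
  rw [Finset.disjoint_left]
  intro a ha hb
  obtain ⟨b, hbS, rfl⟩ := Finset.mem_image.1 hb
  exact hn (Finset.mem_image.2 ⟨(b, (u n)⁻¹ * b), Finset.mem_product.2 ⟨hbS, ha⟩, by simp⟩)

/-- Events that depend on disjoint sets of coordinates are independent. -/
lemma productProb_cylinder_inter_shift (S : Finset F₂) {B : Set (∀ _ : S, Bool)}
    (hB : MeasurableSet B) {g : F₂} (hg : Disjoint S (S.image fun h => g⁻¹ * h)) :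
    productProb (cylinder S B ∩ shift g ⁻¹' cylinder S B) =
      productProb (cylinder S B) * productProb (cylinder S B) := by
  have hind : ProbabilityTheory.iIndepFun (fun (i : F₂) (x : Space) => x i) productProb :=
    ProbabilityTheory.iIndepFun_infinitePi (P := fun _ : F₂ => coin) (X := fun _ b => b)
      fun _ => measurable_id
  have h2 := hind.indepFun_finset _ _ hg fun i => measurable_pi_apply i
  let r : (∀ _ : (S.image fun h => g⁻¹ * h), Bool) → (∀ _ : S, Bool) :=
    fun y i => y ⟨g⁻¹ * i.1, Finset.mem_image_of_mem _ i.2⟩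
  have hr : Measurable r := measurable_pi_lambda _ fun _ => measurable_pi_apply _
  have h3 := h2.measure_inter_preimage_eq_mul B (r ⁻¹' B) hB (hr hB)
  have e : productProb (shift g ⁻¹' cylinder S B) = productProb (cylinder S B) :=
    (measurePreserving_shift g).measure_preimage (hB.cylinder S).nullMeasurableSet
  nth_rw 2 [← e]
  exact h3

/-- Zero-one law: a Borel set invariant under the words of even length is trivial. It is
approximated by a set that depends on finitely many coordinates, which is independent of one of
its translates. -/
lemma productProb_eq_zero_or_one {E : Set Space} (hE : MeasurableSet E)
    (hinv : ∀ g : F₂, Even g.norm → shift g ⁻¹' E = E) :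
    productProb E = 0 ∨ productProb E = 1 := by
  have hdense : productProb.MeasureDense (measurableCylinders fun _ : F₂ => Bool) :=
    Measure.MeasureDense.of_generateFrom_isSetAlgebra_finite _ isSetAlgebra_measurableCylinders
      generateFrom_measurableCylinders.symm
  set p := productProb.real E with hp
  have key : ∀ ε : ℝ, 0 < ε → |p - p ^ 2| ≤ 4 * ε := by
    intro ε hε
    obtain ⟨C, hC, hEC⟩ := hdense.approx E hE (measure_ne_top _ _) ε hε
    have hd : productProb.real (symmDiff E C) ≤ ε :=
      ENNReal.toReal_le_of_le_ofReal hε.le hEC.le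
    obtain ⟨S, B, hB, rfl⟩ := (mem_measurableCylinders C).1 hC
    obtain ⟨g, hg, hdisj⟩ := exists_even_disjoint_image S
    set C : Set Space := cylinder (α := fun _ : F₂ => Bool) S B with hCdef
    have hCm : MeasurableSet C := hB.cylinder S
    have hmul : productProb.real (C ∩ shift g ⁻¹' C) = productProb.real C ^ 2 := by
      rw [measureReal_def, productProb_cylinder_inter_shift S hB hdisj, ENNReal.toReal_mul, sq]
      rfl
    have hd' : productProb.real (symmDiff E (shift g ⁻¹' C)) ≤ ε := by
      have : symmDiff E (shift g ⁻¹' C) = shift g ⁻¹' symmDiff E C := by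
        rw [Set.preimage_symmDiff, hinv g hg]
      rw [this, measureReal_def, (measurePreserving_shift g).measure_preimage
        (hE.symmDiff hCm).nullMeasurableSet]
      exact hd
    have h1 : |p - productProb.real C| ≤ ε :=
      (abs_measureReal_sub_le_measureReal_symmDiff hE.nullMeasurableSet
        hCm.nullMeasurableSet).trans hd
    have h2 : |p - productProb.real C ^ 2| ≤ 2 * ε := by
      rw [← hmul]
      refine (abs_measureReal_sub_le_measureReal_symmDiff hE.nullMeasurableSet
        (hCm.inter (measurable_shift g hCm)).nullMeasurableSet).trans ?_
      have hsub : symmDiff E (C ∩ shift g ⁻¹' C) ⊆ symmDiff E C ∪ symmDiff E (shift g ⁻¹' C) := by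
        intro x hx
        simp only [Set.mem_symmDiff, Set.mem_inter_iff, Set.mem_union] at hx ⊢
        tauto
      have := (measureReal_mono (μ := productProb) hsub).trans (measureReal_union_le _ _)
      linarith
    have hp1 : p ≤ 1 := measureReal_le_one
    have hq1 : productProb.real C ≤ 1 := measureReal_le_one
    have hp0 : 0 ≤ p := measureReal_nonneg
    have hq0 : 0 ≤ productProb.real C := measureReal_nonneg
    rw [abs_le] at h1 h2 ⊢
    constructor <;> nlinarith
  have h0 : p - p ^ 2 = 0 := by
    rw [← abs_eq_zero]
    refine le_antisymm (le_of_forall_pos_le_add fun ε hε => ?_) (abs_nonneg _)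
    have := key (ε / 4) (by positivity)
    linarith
  have h1 : p * (1 - p) = 0 := by linarith
  rcases mul_eq_zero.1 h1 with h | h
  · left
    simpa [hp, measureReal_eq_zero_iff] using h
  · right
    have : productProb.real E = 1 := by linarith
    rw [measureReal_def] at this
    rw [← ENNReal.ofReal_toReal (measure_ne_top productProb E), this, ENNReal.ofReal_one]

/-! ### All colours appear nearby -/

/-- The points from which the colour `j` is not seen by words of odd length at most `N`. -/
def unseen {k : ℕ} (c : Space → Fin k) (j : Fin k) (N : ℕ) : Set Space :=
  {x | ∀ g : F₂, Odd g.norm → g.norm ≤ N → c (shift g x) ≠ j}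

lemma measurableSet_unseen {k : ℕ} {c : Space → Fin k} (hc : Measurable c) (j : Fin k) (N : ℕ) :
    MeasurableSet (unseen c j N) := by
  have : unseen c j N = ⋂ g : F₂, ⋂ _ : Odd g.norm, ⋂ _ : g.norm ≤ N,
      (c ∘ shift g) ⁻¹' {j}ᶜ := by
    ext x; simp [unseen]
  rw [this]
  exact MeasurableSet.iInter fun g => MeasurableSet.iInter fun _ => MeasurableSet.iInter fun _ =>
    (hc.comp (measurable_shift g)) (measurableSet_singleton j).compl

lemma IsOriginalColouring.productProb_iInter_unseen {k : ℕ} {c : Space → Fin k}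
    (hc : IsOriginalColouring k c) (j : Fin k) : productProb (⋂ N, unseen c j N) = 0 := by
  have hE : MeasurableSet (⋂ N, unseen c j N) :=
    MeasurableSet.iInter fun N => measurableSet_unseen hc.measurable j N
  have hmem : ∀ x, x ∈ ⋂ N, unseen c j N ↔ ∀ g : F₂, Odd g.norm → c (shift g x) ≠ j := by
    intro x
    simp only [Set.mem_iInter, unseen]
    exact ⟨fun h g hg => h _ g hg le_rfl, fun h N g hg _ => h g hg⟩
  refine (productProb_eq_zero_or_one hE fun h hh => ?_).resolve_right fun h1 => ?_
  · ext x
    rw [Set.mem_preimage, hmem, hmem]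
    constructor
    · intro hx g hg
      have := hx (g * h⁻¹) (by
        rw [← Nat.not_even_iff_odd] at hg ⊢
        rw [even_norm_mul, FreeGroup.norm_inv_eq]
        tauto)
      rwa [← shift_mul, inv_mul_cancel_right] at this
    · intro hx g hg
      rw [← shift_mul]
      refine hx _ ?_
      rw [← Nat.not_even_iff_odd] at hg ⊢
      rw [even_norm_mul]
      tauto
  · have hpos : 0 < productProb (c ⁻¹' {j}) :=
      (hc.pos j).trans_le (measure_mono Set.inter_subset_right)
    have hm : MeasurableSet (c ⁻¹' {j}) := hc.measurable (measurableSet_singleton j)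
    rw [← (measurePreserving_shift (FreeGroup.of 0)).measure_preimage hm.nullMeasurableSet] at hpos
    have hsub : shift (FreeGroup.of 0) ⁻¹' (c ⁻¹' {j}) ⊆ (⋂ N, unseen c j N)ᶜ := by
      intro x hx h
      exact (hmem x).1 h (FreeGroup.of 0) (by simp) hx
    have h0 : productProb (⋂ N, unseen c j N)ᶜ = 0 := by
      rw [prob_compl_eq_zero_iff hE, h1]
    exact absurd (measure_mono_null hsub h0) hpos.ne'

lemma IsOriginalColouring.exists_coloursAppear {k : ℕ} {c : Space → Fin k}
    (hc : IsOriginalColouring k c) {ε : ℝ≥0∞} (hε : 0 < ε) : ∃ (N : ℕ) (Q : Set Space),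
      Odd N ∧ MeasurableSet Q ∧ productProb Q ≤ ε ∧ ColoursAppear c N Q := by
  have hanti : ∀ j, Antitone (unseen c j) := fun j N M hNM x hx g hg hgN =>
    hx g hg (hgN.trans hNM)
  have hlim : Filter.Tendsto (fun N => ∑ j, productProb (unseen c j N)) Filter.atTop (nhds 0) := by
    have : Filter.Tendsto (fun N => ∑ j, productProb (unseen c j N)) Filter.atTop
        (nhds (∑ _j : Fin k, 0)) := by
      refine tendsto_finsetSum _ fun j _ => ?_
      rw [← hc.productProb_iInter_unseen j]
      exact tendsto_measure_iInter_atTop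
        (fun N => (measurableSet_unseen hc.measurable j N).nullMeasurableSet) (hanti j)
        ⟨0, measure_ne_top _ _⟩
    simpa using this
  obtain ⟨N, hN⟩ := Filter.eventually_atTop.1 (hlim.eventually (gt_mem_nhds hε))
  refine ⟨2 * N + 1, ⋃ j, unseen c j (2 * N + 1), odd_two_mul_add_one N,
    MeasurableSet.iUnion fun j => measurableSet_unseen hc.measurable j _, ?_, ?_⟩
  · exact (measure_iUnion_fintype_le _ _).trans (hN (2 * N + 1) (by omega)).le
  · rintro x ⟨-, hx⟩ j
    by_contra! hcon
    exact hx (Set.mem_iUnion.2 ⟨j, fun g hg hgN => hcon g hg hgN⟩)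


/-! ### Proper list colourings -/

/-- The orbit equivalence relation of the shift. -/
def orbitSetoid : Setoid Space where
  r x y := ∃ g, shift g x = y
  iseqv :=
    { refl := fun x => ⟨1, shift_one x⟩
      symm := fun ⟨g, h⟩ => ⟨g⁻¹, by rw [← h, shift_inv_shift]⟩
      trans := fun ⟨g, h⟩ ⟨g', h'⟩ => ⟨g' * g, by rw [shift_mul, h, h']⟩ }

/-- A point chosen in each orbit. -/
noncomputable def root (x : Space) : Space := (Quotient.mk orbitSetoid x).out

lemma exists_shift_root (x : Space) : ∃ g, shift g (root x) = x :=
  Quotient.mk_out (s := orbitSetoid) x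

lemma root_shift (g : F₂) (x : Space) : root (shift g x) = root x :=
  congrArg Quotient.out (Quotient.sound (s := orbitSetoid) ⟨g⁻¹, shift_inv_shift g x⟩)

/-- Arrows can be chosen so that no point is hit twice: each orbit is a tree, at least one of the
two arrows that are possible at a point leads away from the root, and a point has only one
neighbour that is closer to the root. -/
lemma exists_injective_arrows : ∃ a : Space → Space, (∀ x, PotentialArrow x (a x)) ∧
    ∀ x ∈ freePart, ∀ y ∈ freePart, a x = a y → x = y := by
  choose w hw using exists_shift_root
  choose i hi using fun x : Space => exists_toWord_dir_mul (x 1) (w x)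
  refine ⟨fun x => shift (dir (i x) (x 1)) x, fun x => ⟨i x, rfl⟩, fun x hx y hy h => ?_⟩
  have hr : root x = root y := by
    rw [← root_shift (dir (i x) (x 1)) x, ← root_shift (dir (i y) (y 1)) y]
    exact congrArg root h
  have hroot : root x ∈ freePart := by
    rw [← shift_mem_freePart_iff (w x), hw]; exact hx
  have h' : shift (dir (i x) (x 1) * w x) (root x) = shift (dir (i y) (y 1) * w y) (root x) := by
    rw [shift_mul, hw, shift_mul, hr, hw]
    exact h
  rw [shift_inj_of_mem_freePart hroot] at h'
  have hwords := hi x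
  rw [h', hi y, List.cons.injEq] at hwords
  rw [← hw x, ← hw y, hr, FreeGroup.toWord_injective hwords.2]

/-- Two points to which arrows could be directed from the same point differ by a short move. -/
lemma PotentialArrow.exists_shortMove {x z z' : Space} (h : PotentialArrow x z)
    (h' : PotentialArrow x z') : ∃ g, (g = 1 ∨ g ∈ shortMoves) ∧ z' = shift g z := by
  obtain ⟨i, rfl⟩ := h
  obtain ⟨j, rfl⟩ := h'
  refine ⟨dir j (x 1) * dir i (!(x 1)), ?_, ?_⟩
  · by_cases hij : j = i
    · left
      rw [hij, dir_not, mul_inv_cancel]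
    · exact Or.inr (dir_mul_dir_mem_shortMoves rfl hij)
  · rw [shift_mul, dir_not, shift_inv_shift]

lemma IsOriginalColouring.exists_isListColouring {k : ℕ} {c : Space → Fin k}
    (hc : IsOriginalColouring k c) : ∃ e : Space → Fin k, IsListColouring c e := by
  obtain ⟨a, ha, hinj⟩ := exists_injective_arrows
  refine ⟨fun x => c (a x), fun x _ => ⟨a x, ha x, rfl⟩, ?_⟩
  rintro x y ⟨hne, hx, hy, z, hxz, hyz⟩ he
  have hay : a x ≠ a y := fun h => hne (hinj x hx y hy h)
  obtain ⟨g, hg, hgz⟩ := hxz.exists_shortMove (ha x)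
  obtain ⟨h, hh, hhz⟩ := hyz.exists_shortMove (ha y)
  have hshift : a y = shift (h * g⁻¹) (a x) := by
    rw [shift_mul, hgz, shift_inv_shift, hhz]
  have hne1 : h * g⁻¹ ≠ 1 := by
    intro h1
    rw [h1, shift_one] at hshift
    exact hay hshift.symm
  have hmem : h * g⁻¹ ∈ shortMoves ∪ longMoves := by
    rcases hg with rfl | hg <;> rcases hh with rfl | hh
    · simp at hne1
    · left; simpa using hh
    · left; simpa using inv_mem_shortMoves hg
    · exact Or.inr (shortMoves_mul hh (inv_mem_shortMoves hg) hne1)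
  have hax : a x ∈ freePart := by
    obtain ⟨i, hi⟩ := ha x
    rw [hi, shift_mem_freePart_iff]
    exact hx
  refine hc.ne_of_move (a x) hax _ hmem ?_
  rw [← hshift]
  exact he.symm

/-- A proper list colouring of the first copy and the original colouring of the second copy form a
proper colouring of the graph on the two copies. -/
lemma IsListColouring.ne_of_adj {k : ℕ} {c e : Space → Fin k} (he : IsListColouring c e) {N : ℕ}
    {Q : Set Space} {v w : TwoCopies} (h : (doubleGraph c N Q).Adj v w) :
    (if v.2 then c v.1 else e v.1) ≠ (if w.2 then c w.1 else e w.1) := by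
  have key : ∀ v w : TwoCopies, Link c N Q v w →
      (if v.2 then c v.1 else e v.1) ≠ (if w.2 then c w.1 else e w.1) := by
    rintro _ _ (⟨-, -, hxy⟩ | ⟨-, -, -, hne⟩ | ⟨hx, -, -, -, hne⟩)
    · simpa using he.2 _ _ hxy
    · simpa using hne.symm
    · obtain ⟨z, hz, hez⟩ := he.1 _ hx
      simpa [hez] using (hne z hz).symm
  rcases (SimpleGraph.fromRel_adj _ _ _).1 h with ⟨-, h | h⟩
  · exact key v w h
  · exact (key w v h).symm


/-! ### The measure and the descendants on the two copies -/

lemma twoCopyMeasure_prod (E : Set Space) (b : Bool) :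
    twoCopyMeasure (E ×ˢ {b}) = productProb E * 2⁻¹ := by
  rw [twoCopyMeasure, Measure.prod_prod, coin_singleton]

lemma ae_twoCopyMeasure_fst {p : Space → Prop} (h : ∀ᵐ x ∂productProb, p x) :
    ∀ᵐ v ∂twoCopyMeasure, p v.1 :=
  (measurePreserving_fst (μ := productProb) (ν := coin)).quasiMeasurePreserving.ae h

lemma ae_productProb_of_ae_twoCopyMeasure {p : TwoCopies → Prop}
    (h : ∀ᵐ v ∂twoCopyMeasure, p v) : ∀ᵐ x ∂productProb, ∀ b, p (x, b) := by
  rw [ae_all_iff]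
  intro b
  rw [ae_iff] at h ⊢
  have h' := measure_mono_null (s := {x | ¬ p (x, b)} ×ˢ {b}) (fun v hv => by
    obtain ⟨x, b'⟩ := v
    obtain ⟨hx, rfl⟩ := hv
    exact hx) h
  rw [twoCopyMeasure_prod] at h'
  simpa using h'

lemma ae_forall_shift {p : Space → Prop} (h : ∀ᵐ x ∂productProb, p x) :
    ∀ᵐ x ∂productProb, ∀ g, p (shift g x) := by
  rw [ae_all_iff]
  exact fun g => (measurePreserving_shift g).quasiMeasurePreserving.ae h

lemma measurePreserving_not_coin : MeasurePreserving (fun b : Bool => !b) coin coin := by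
  refine ⟨measurable_of_countable _, Measure.ext_of_singleton fun b => ?_⟩
  rw [Measure.map_apply (measurable_of_countable _) (measurableSet_singleton b)]
  have : (fun b : Bool => !b) ⁻¹' {b} = {!b} := by
    ext a; cases a <;> cases b <;> simp
  rw [this, coin_singleton, coin_singleton]

lemma measurePreserving_desc (N : ℕ) (g : Move N) :
    MeasurePreserving (desc N g) twoCopyMeasure twoCopyMeasure := by
  by_cases h : Even g.1.norm
  · have : desc N g = Prod.map (shift g.1) id := by
      funext v; simp [desc, h, Prod.map]
    rw [this]
    exact (measurePreserving_shift g.1).prod (MeasurePreserving.id coin)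
  · have : desc N g = Prod.map (shift g.1) fun b => !b := by
      funext v; simp [desc, h, Prod.map]
    rw [this]
    exact (measurePreserving_shift g.1).prod measurePreserving_not_coin

instance (N : ℕ) : Finite (Move N) := by
  have : {g : F₂ | g ≠ 1 ∧ ((Even g.norm ∧ g.norm ≤ 2 * N + 10) ∨
      (Odd g.norm ∧ g.norm ≤ N))}.Finite :=
    (finite_norm_le (2 * N + 10)).subset fun g hg => by
      rcases hg.2 with h | h
      · exact h.2
      · exact h.2.trans (by omega)
  exact this.to_subtype

/-- The inverse of a move. -/
def Move.inv {N : ℕ} (g : Move N) : Move N :=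
  ⟨g.1⁻¹, inv_ne_one.2 g.2.1, by rw [FreeGroup.norm_inv_eq]; exact g.2.2⟩

lemma desc_inv_desc {N : ℕ} (g : Move N) (v : TwoCopies) : desc N g.inv (desc N g v) = v := by
  have : g.inv.1.norm = g.1.norm := FreeGroup.norm_inv_eq
  simp only [desc, this]
  simp only [Move.inv, shift_inv_shift]
  split_ifs <;> simp

/-- The move given by a word of even length. -/
def Move.ofEven {N : ℕ} (g : F₂) (hg : g ≠ 1) (he : Even g.norm) (hN : g.norm ≤ 2 * N + 10) :
    Move N := ⟨g, hg, Or.inl ⟨he, hN⟩⟩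

/-- The move given by a word of odd length. -/
def Move.ofOdd {N : ℕ} (g : F₂) (ho : Odd g.norm) (hN : g.norm ≤ N) : Move N :=
  ⟨g, fun h => by simp [h] at ho, Or.inr ⟨ho, hN⟩⟩

lemma desc_ofEven {N : ℕ} (g : F₂) (hg : g ≠ 1) (he : Even g.norm) (hN : g.norm ≤ 2 * N + 10)
    (v : TwoCopies) : desc N (Move.ofEven g hg he hN) v = (shift g v.1, v.2) := by
  simp [desc, Move.ofEven, he]

lemma desc_ofOdd {N : ℕ} (g : F₂) (ho : Odd g.norm) (hN : g.norm ≤ N) (v : TwoCopies) :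
    desc N (Move.ofOdd g ho hN) v = (shift g v.1, !v.2) := by
  have : ¬ Even g.norm := Nat.not_even_iff_odd.2 ho
  simp [desc, Move.ofOdd, this]

/-! ### The graph on the two copies -/

lemma Link.exists_desc {k : ℕ} {c : Space → Fin k} {N : ℕ} {Q : Set Space} {v w : TwoCopies}
    (h : Link c N Q v w) : ∃ g, desc N g v = w := by
  rcases h with ⟨-, -, hne, hx, hy, z, ⟨i, hi⟩, ⟨j, hj⟩⟩ | ⟨hx, he, hN, hne⟩ | ⟨hx, -, ho, hN, -⟩
  · rename_i x y
    have hxy : shift ((dir j (y 1))⁻¹ * dir i (x 1)) x = y := by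
      rw [shift_mul, ← hi, hj, shift_inv_shift]
    have hn := FreeGroup.norm_mul_le (dir j (y 1))⁻¹ (dir i (x 1))
    rw [FreeGroup.norm_inv_eq, norm_dir, norm_dir] at hn
    refine ⟨Move.ofEven ((dir j (y 1))⁻¹ * dir i (x 1)) (fun h => ?_) ?_ (by omega), ?_⟩
    · rw [h, shift_one] at hxy
      exact hne hxy
    · rw [even_norm_mul, FreeGroup.norm_inv_eq, norm_dir, norm_dir]
    · rw [desc_ofEven, hxy]
  · refine ⟨Move.ofEven _ (fun h => ?_) he hN, desc_ofEven _ _ _ _ _⟩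
    rw [h, shift_one] at hne
    exact hne rfl
  · exact ⟨Move.ofOdd _ ho hN, desc_ofOdd _ _ _ _⟩

lemma exists_desc_of_adj {k : ℕ} {c : Space → Fin k} {N : ℕ} {Q : Set Space} {v w : TwoCopies}
    (h : (doubleGraph c N Q).Adj v w) : ∃ g, desc N g v = w := by
  rcases (SimpleGraph.fromRel_adj _ _ _).1 h with ⟨-, h | h⟩
  · exact h.exists_desc
  · obtain ⟨g, rfl⟩ := h.exists_desc
    exact ⟨g.inv, desc_inv_desc g w⟩

lemma encard_neighborSet_le {k : ℕ} (c : Space → Fin k) (N : ℕ) (Q : Set Space) (v : TwoCopies) :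
    ((doubleGraph c N Q).neighborSet v).encard ≤ Nat.card (Move N) := by
  have hsub : (doubleGraph c N Q).neighborSet v ⊆ (fun g => desc N g v) '' Set.univ := by
    intro w hw
    obtain ⟨g, hg⟩ := exists_desc_of_adj hw
    exact ⟨g, trivial, hg⟩
  refine (Set.encard_le_encard hsub).trans ((Set.encard_image_le _ _).trans ?_)
  rw [Set.encard_univ, ENat.card_eq_coe_natCard]

/-- One of the two points to which an arrow could be directed from `x`. -/
def arrowTarget (i : Fin 2) (x : Space) : Space := shift (dir i (x 1)) x

@[fun_prop]
lemma measurable_arrowTarget (i : Fin 2) : Measurable (arrowTarget i) := by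
  have : arrowTarget i = fun x => if x 1 = true then shift (dir i true) x
      else shift (dir i false) x := by
    funext x
    cases h : x 1 <;> simp [arrowTarget, h]
  rw [this]
  exact Measurable.ite (measurable_pi_apply _ (measurableSet_singleton _))
    (measurable_shift _) (measurable_shift _)

lemma measurableSet_ne_fun {α β : Type*} [MeasurableSpace α] [MeasurableSpace β]
    [MeasurableEq β] {f g : α → β} (hf : Measurable f) (hg : Measurable g) :
    MeasurableSet {x | f x ≠ g x} := (measurableSet_eq_fun hf hg).compl

/-- The defining conditions of `Link` in terms of countably many Borel conditions. -/
lemma link_iff {k : ℕ} {c : Space → Fin k} {N : ℕ} {Q : Set Space} {v w : TwoCopies} :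
    Link c N Q v w ↔
      (v.2 = false ∧ w.2 = false ∧ v.1 ∉ Q ∧ w.1 ∉ Q ∧ v.1 ≠ w.1 ∧ v.1 ∈ freePart ∧
        w.1 ∈ freePart ∧ ∃ i j, arrowTarget i v.1 = arrowTarget j w.1) ∨
      (v.2 = true ∧ w.2 = true ∧ v.1 ∈ freePart ∧ c w.1 ≠ c v.1 ∧
        ∃ g : F₂, (Even g.norm ∧ g.norm ≤ 2 * N + 10) ∧ w.1 = shift g v.1) ∨
      (v.2 = false ∧ w.2 = true ∧ v.1 ∈ freePart ∧ v.1 ∉ Q ∧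
        (∀ i, c w.1 ≠ c (arrowTarget i v.1)) ∧
        ∃ g : F₂, (Odd g.norm ∧ g.norm ≤ N) ∧ w.1 = shift g v.1) := by
  constructor
  · rintro (⟨hx, hy, hne, hfx, hfy, z, ⟨i, hi⟩, ⟨j, hj⟩⟩ | ⟨hx, he, hN, hne⟩ |
      ⟨hx, hxQ, ho, hN, hz⟩)
    · exact Or.inl ⟨rfl, rfl, hx, hy, hne, hfx, hfy, i, j, hi.symm.trans hj⟩
    · exact Or.inr (Or.inl ⟨rfl, rfl, hx, hne, _, ⟨he, hN⟩, rfl⟩)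
    · exact Or.inr (Or.inr ⟨rfl, rfl, hx, hxQ, fun i => hz _ ⟨i, rfl⟩, _, ⟨ho, hN⟩, rfl⟩)
  · obtain ⟨x, b⟩ := v
    obtain ⟨y, b'⟩ := w
    rintro (⟨rfl, rfl, hx, hy, hne, hfx, hfy, i, j, h⟩ | ⟨rfl, rfl, hx, hne, g, ⟨he, hN⟩, h⟩ |
      ⟨rfl, rfl, hx, hxQ, hz, g, ⟨ho, hN⟩, h⟩)
    · exact Link.clique hx hy ⟨hne, hfx, hfy, _, ⟨i, rfl⟩, ⟨j, h⟩⟩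
    · dsimp only at h hne hx
      subst h
      exact Link.second hx he hN hne
    · dsimp only at h hz hx
      subst h
      exact Link.cross hx hxQ ho hN (by rintro z ⟨i, rfl⟩; exact hz i)

lemma measurableSet_link {k : ℕ} {c : Space → Fin k} (hc : Measurable c) (N : ℕ) {Q : Set Space}
    (hQ : MeasurableSet Q) {f g : TwoCopies → TwoCopies} (hf : Measurable f) (hg : Measurable g) :
    MeasurableSet {v | Link c N Q (f v) (g v)} := by
  have hbool : ∀ (u : TwoCopies → TwoCopies) (b : Bool), Measurable u →
      MeasurableSet {v | (u v).2 = b} := fun u b hu =>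
    hu.snd (measurableSet_singleton b)
  have hmem : ∀ (u : TwoCopies → TwoCopies) (E : Set Space), Measurable u → MeasurableSet E →
      MeasurableSet {v | (u v).1 ∈ E} := fun u E hu hE => hu.fst hE
  have hword : ∀ p : F₂ → Prop, MeasurableSet {v | ∃ h, p h ∧ (g v).1 = shift h (f v).1} := by
    intro p
    have : {v | ∃ h, p h ∧ (g v).1 = shift h (f v).1} =
        ⋃ h, ⋃ _ : p h, {v | (g v).1 = shift h (f v).1} := by
      ext v; simp
    rw [this]
    exact MeasurableSet.iUnion fun h => MeasurableSet.iUnion fun _ =>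
      measurableSet_eq_fun hg.fst ((measurable_shift h).comp hf.fst)
  simp only [link_iff]
  refine MeasurableSet.union ?_ (MeasurableSet.union ?_ ?_)
  · refine (hbool f false hf).inter ((hbool g false hg).inter ((hmem f _ hf hQ.compl).inter
      ((hmem g _ hg hQ.compl).inter ((measurableSet_ne_fun hf.fst hg.fst).inter
      ((hmem f _ hf measurableSet_freePart).inter
      ((hmem g _ hg measurableSet_freePart).inter ?_))))))
    have : {v | ∃ i j, arrowTarget i (f v).1 = arrowTarget j (g v).1} =
        ⋃ i, ⋃ j, {v | arrowTarget i (f v).1 = arrowTarget j (g v).1} := by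
      ext v; simp
    change MeasurableSet {v | ∃ i j, arrowTarget i (f v).1 = arrowTarget j (g v).1}
    rw [this]
    exact MeasurableSet.iUnion fun i => MeasurableSet.iUnion fun j =>
      measurableSet_eq_fun ((measurable_arrowTarget i).comp hf.fst)
        ((measurable_arrowTarget j).comp hg.fst)
  · exact (hbool f true hf).inter ((hbool g true hg).inter
      ((hmem f _ hf measurableSet_freePart).inter
      ((measurableSet_ne_fun (hc.comp hg.fst) (hc.comp hf.fst)).inter (hword _))))
  · refine (hbool f false hf).inter ((hbool g true hg).inter
      ((hmem f _ hf measurableSet_freePart).inter ((hmem f _ hf hQ.compl).inter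
      (MeasurableSet.inter ?_ (hword _)))))
    have : {v | ∀ i, c (g v).1 ≠ c (arrowTarget i (f v).1)} =
        ⋂ i, {v | c (g v).1 ≠ c (arrowTarget i (f v).1)} := by
      ext v; simp
    change MeasurableSet {v | ∀ i, c (g v).1 ≠ c (arrowTarget i (f v).1)}
    rw [this]
    exact MeasurableSet.iInter fun i => measurableSet_ne_fun (hc.comp hg.fst)
      (hc.comp ((measurable_arrowTarget i).comp hf.fst))

lemma measurableSet_adj_desc {k : ℕ} {c : Space → Fin k} (hc : Measurable c) (N : ℕ)
    {Q : Set Space} (hQ : MeasurableSet Q) (g : Move N) :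
    MeasurableSet {v | (doubleGraph c N Q).Adj v (desc N g v)} := by
  have hd := (measurePreserving_desc N g).measurable
  simp only [doubleGraph, SimpleGraph.fromRel_adj]
  exact (measurableSet_ne_fun measurable_id hd).inter
    ((measurableSet_link hc N hQ measurable_id hd).union
      (measurableSet_link hc N hQ hd measurable_id))


/-! ### The rule is a colouring rule and is not stationary -/

lemma ae_desc_ne (N : ℕ) : ∀ᵐ v ∂twoCopyMeasure, ∀ g, desc N g v ≠ v := by
  filter_upwards [ae_twoCopyMeasure_fst ae_mem_freePart] with v hv g h
  exact hv g.1 g.2.1 (congrArg Prod.fst h)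

lemma isColouringRule_properRule {k : ℕ} {c : Space → Fin k} (hc : Measurable c) (N : ℕ)
    {Q : Set Space} (hQ : MeasurableSet Q) :
    IsColouringRule twoCopyMeasure (desc N)
      (properRule (A := Fin k) (doubleGraph c N Q) (desc N)) where
  finite_desc := inferInstance
  measurePreserving := measurePreserving_desc N
  irreflexive := ae_desc_ne N
  measurable_graph := by
    have : {p : Fin k × (NullMeasurableSpace TwoCopies twoCopyMeasure × (Move N → Fin k)) |
        p.1 ∈ properRule (doubleGraph c N Q) (desc N) p.2.1 p.2.2} =
        ⋂ g : Move N, ({p | (doubleGraph c N Q).Adj p.2.1 (desc N g p.2.1)}ᶜ ∪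
          {p | p.1 ≠ p.2.2 g}) := by
      ext p
      simp [properRule, imp_iff_not_or]
    rw [this]
    refine MeasurableSet.iInter fun g => MeasurableSet.union (MeasurableSet.compl ?_) ?_
    · have h : @MeasurableSet (NullMeasurableSpace TwoCopies twoCopyMeasure) _
          {v | (doubleGraph c N Q).Adj v (desc N g v)} :=
        (measurableSet_adj_desc hc N hQ g).nullMeasurableSet
      exact measurable_snd.fst h
    · exact measurableSet_ne_fun measurable_fst ((measurable_pi_apply g).comp measurable_snd.snd)

/-- For the descendant given by `T₁⁻¹ T₂` the edge from `x` to `T₁⁻¹ T₂ x` in the first copy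
depends on the coordinates of these two points at the identity. -/
lemma not_isStationary {k : ℕ} {c : Space → Fin k} (hc : IsOriginalColouring k c) (N : ℕ)
    {Q : Set Space} (hQm : MeasurableSet Q) (hQ : productProb Q < 1 / 512) :
    ¬ IsStationary twoCopyMeasure (properRule (A := Fin k) (doubleGraph c N Q) (desc N)) := by
  classical
  rintro ⟨F₀, hF₀⟩
  let g : F₂ := dir 0 false * dir 1 true
  have hgs : g ∈ shortMoves := dir_mul_dir_mem_shortMoves rfl (by decide)
  have hgn : g.norm = 2 := shortMoves_norm hgs
  have hg1 : g ≠ 1 := fun h => by simp [h] at hgn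
  let G : Move N := Move.ofEven g hg1 (by rw [hgn]; decide) (by omega)
  have hG : ∀ x, desc N G (x, false) = (shift g x, false) := fun x => desc_ofEven _ _ _ _ _
  obtain ⟨x₀, hx₀⟩ := ae_mem_freePart.exists
  have hcol : c (shift g x₀) ≠ c x₀ := hc.ne_of_move x₀ hx₀ g (Or.inl hgs)
  -- The colour of `x₀` is used by this descendant only, so it is allowed iff there is no edge.
  let b : Move N → Fin k := fun i => if i = G then c x₀ else c (shift g x₀)
  have hb : ∀ v, c x₀ ∈ properRule (doubleGraph c N Q) (desc N) v b ↔
      ¬ (doubleGraph c N Q).Adj v (desc N G v) := by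
    intro v
    constructor
    · intro h hadj
      exact h G hadj (by simp [b])
    · intro h i hadj
      have hi : i ≠ G := fun e => h (e ▸ hadj)
      simpa [b, hi] using hcol.symm
  have hfree := ae_twoCopyMeasure_fst ae_mem_freePart
  have hlow : ∀ (S : Finset F₂) (v : F₂ → Bool) (P : Set Space), S.card ≤ 2 →
      productProb P < 1 / 4 → twoCopyMeasure (({x | ∀ h ∈ S, x h = v h} \ P) ×ˢ {false}) ≠ 0 := by
    intro S v P hS hP h0
    rw [twoCopyMeasure_prod] at h0
    have h1 : productProb ({x | ∀ h ∈ S, x h = v h} \ P) = 0 := by simpa using h0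
    have h2 : (1 / 4 : ℝ≥0∞) ≤ productProb {x | ∀ h ∈ S, x h = v h} := by
      rw [productProb_cylinder]
      calc (1 / 4 : ℝ≥0∞) = 2⁻¹ ^ 2 := by
            rw [← ENNReal.inv_pow, one_div]; norm_num
        _ ≤ _ := pow_le_pow_right_of_le_one' (by simp) hS
    have h3 := measure_le_inter_add_sdiff productProb {x : Space | ∀ h ∈ S, x h = v h} P
    rw [h1, add_zero] at h3
    exact absurd (h2.trans (h3.trans (measure_mono Set.inter_subset_right))) (not_le.2 hP)
  obtain ⟨⟨x, _⟩, ⟨⟨hx1, hxQ⟩, rfl⟩, hxF, hx⟩ :=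
    ((frequently_ae_mem_iff.2 (hlow {1, g⁻¹} (fun _ => true) (Q ∪ shift g ⁻¹' Q)
      Finset.card_le_two (by
        refine (measure_union_le _ _).trans_lt ?_
        rw [(measurePreserving_shift g).measure_preimage hQm.nullMeasurableSet]
        refine (ENNReal.add_lt_add hQ hQ).trans_le ?_
        rw [← ENNReal.toReal_le_toReal (by simp) (by simp), ENNReal.toReal_add (by simp) (by simp)]
        norm_num))).and_eventually
      (hF₀.and hfree)).exists
  obtain ⟨⟨y, _⟩, ⟨⟨hy1, -⟩, rfl⟩, hyF, hy⟩ :=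
    ((frequently_ae_mem_iff.2 (hlow {1} (fun _ => false) ∅ (by simp) (by simp))).and_eventually
      (hF₀.and hfree)).exists
  dsimp only at hx hy hxF hyF
  have hxx : x 1 = true := hx1 1 (by simp)
  have hxg : shift g x 1 = true := by
    rw [shift_apply_one]; exact hx1 _ (by simp)
  have hyy : y 1 = false := hy1 1 (by simp)
  have hxadj : (doubleGraph c N Q).Adj (x, false) (desc N G (x, false)) := by
    rw [hG]
    have hne : x ≠ shift g x := fun h => hx g hg1 h.symm
    refine (SimpleGraph.fromRel_adj _ _ _).2 ⟨fun h => hne (congrArg Prod.fst h), Or.inl ?_⟩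
    refine Link.clique (fun h => hxQ (Or.inl h))
      (fun h => hxQ (Or.inr h))
      ⟨hne, hx, (shift_mem_freePart_iff g).2 hx, shift (dir 1 true) x, ⟨1, by rw [hxx]⟩,
        ⟨0, ?_⟩⟩
    rw [hxg, ← shift_mul, ← mul_assoc, show (dir 0 false) = (dir 0 true)⁻¹ from dir_not 0 true,
      mul_inv_cancel, one_mul]
  have hyadj : ¬ (doubleGraph c N Q).Adj (y, false) (desc N G (y, false)) := by
    rw [hG]
    -- No arrow from `y` and arrow from `T₁⁻¹ T₂ y` can have the same target, as the words differ.
    have hwords : ∀ (i j : Fin 2) (s : Bool), dir i false ≠ dir j s * g := by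
      decide
    have hno : ¬ secondaryGraph.Adj y (shift g y) := by
      rintro ⟨-, -, -, z, ⟨i, hi⟩, ⟨j, hj⟩⟩
      rw [hi, hyy, ← shift_mul, shift_inj_of_mem_freePart hy] at hj
      exact hwords i j _ hj
    have hlink : ∀ {u v : Space}, Link c N Q (u, false) (v, false) → secondaryGraph.Adj u v := by
      rintro u v (⟨-, -, h⟩ | _ | _)
      exact h
    intro h
    rcases (SimpleGraph.fromRel_adj _ _ _).1 h with ⟨-, h | h⟩
    · exact hno (hlink h)
    · exact hno (hlink h).symm
  exact (hb _).1 (by rw [hxF, ← hyF]; exact (hb _).2 hyadj) hxadj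


/-! ### Colourings that satisfy the rule -/

/-- The points of the free part on whose orbit `d` is, in both copies, a proper colouring. -/
def properOrbits {k : ℕ} (G : SimpleGraph TwoCopies) (d : TwoCopies → Fin k) : Set Space :=
  {x | x ∈ freePart ∧ ∀ g b w, G.Adj (shift g x, b) w → d (shift g x, b) ≠ d w}

lemma ae_mem_properOrbits {k : ℕ} {c : Space → Fin k} {N : ℕ} {Q : Set Space}
    {d : TwoCopies → Fin k}
    (hd : Satisfies twoCopyMeasure (desc N) (properRule (doubleGraph c N Q) (desc N)) d) :
    ∀ᵐ x ∂productProb, x ∈ properOrbits (doubleGraph c N Q) d := by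
  filter_upwards [ae_mem_freePart,
    ae_forall_shift (ae_productProb_of_ae_twoCopyMeasure hd)] with x hx h
  refine ⟨hx, fun g b w hw => ?_⟩
  obtain ⟨i, rfl⟩ := exists_desc_of_adj hw
  exact h g b i hw

/-- In the second copy the points at odd distance at most `N` from `x` are coloured by a
permutation of the original colours, because all of these appear and because points with different
original colours are adjacent. In the first copy the colours available to `x` are therefore those
of the two possible targets. -/
lemma exists_arrow {k : ℕ} {c : Space → Fin k} {N : ℕ} (hN : Odd N) {Q : Set Space}
    (hQ : ColoursAppear c N Q) {d : TwoCopies → Fin k} {x : Space}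
    (hx : x ∈ properOrbits (doubleGraph c N Q) d) (hxQ : x ∉ Q) :
    ∃ i, d (x, false) = d (arrowTarget i x, true) := by
  obtain ⟨hxf, hd⟩ := hx
  choose g hgo hgN hgc using hQ x ⟨hxf, hxQ⟩
  have hne : ∀ u v : F₂, Odd u.norm → Odd v.norm → u.norm ≤ N → v.norm ≤ N →
      c (shift v x) ≠ c (shift u x) → d (shift u x, true) ≠ d (shift v x, true) := by
    intro u v hu hv huN hvN hc
    refine hd u true _ ((SimpleGraph.fromRel_adj _ _ _).2 ⟨fun h => ?_, Or.inl ?_⟩)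
    · exact hc (congrArg (fun p : TwoCopies => c p.1) h).symm
    · have hs : shift (v * u⁻¹) (shift u x) = shift v x := by
        rw [← shift_mul, inv_mul_cancel_right]
      have hn := FreeGroup.norm_mul_le v u⁻¹
      rw [FreeGroup.norm_inv_eq] at hn
      rw [← Nat.not_even_iff_odd] at hu hv
      have := Link.second (c := c) (N := N) (Q := Q) (x := shift u x) (g := v * u⁻¹)
        ((shift_mem_freePart_iff u).2 hxf)
        (by rw [even_norm_mul, FreeGroup.norm_inv_eq]; tauto) (by omega) (by rwa [hs])
      rwa [hs] at this
  let σ : Fin k → Fin k := fun j => d (shift (g j) x, true)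
  have hσ : Function.Injective σ := by
    intro j l h
    by_contra hjl
    exact hne (g j) (g l) (hgo j) (hgo l) (hgN j) (hgN l)
      (by rw [hgc, hgc]; exact fun h => hjl h.symm) h
  have hsurj : Function.Surjective σ := Finite.surjective_of_injective hσ
  obtain ⟨j, hj⟩ := hsurj (d (x, false))
  obtain ⟨i, hi⟩ : ∃ i, j = c (arrowTarget i x) := by
    by_contra! hcon
    have h1 := hd 1 false (shift (g j) x, true) (by
      rw [shift_one]
      refine (SimpleGraph.fromRel_adj _ _ _).2
        ⟨fun h => Bool.false_ne_true (congrArg Prod.snd h), Or.inl ?_⟩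
      refine Link.cross hxf hxQ (hgo j) (hgN j) ?_
      rintro z ⟨i, rfl⟩
      rw [hgc]
      exact hcon i)
    rw [shift_one] at h1
    exact h1 hj.symm
  refine ⟨i, ?_⟩
  obtain ⟨l, hl⟩ := hsurj (d (arrowTarget i x, true))
  rcases eq_or_ne l j with rfl | hlj
  · exact hj.symm.trans hl
  · refine absurd hl (hne (g l) (dir i (x 1)) (hgo l) (by rw [norm_dir]; decide) (hgN l)
      (by rw [norm_dir]; exact hN.pos) ?_)
    rw [hgc]
    change c (arrowTarget i x) ≠ l
    rw [← hi]
    exact hlj.symm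

/-- Off `Q` the possible sources of a point form a clique, so at most one of them directs an arrow
to it. -/
lemma arrow_source_unique {k : ℕ} {c : Space → Fin k} {N : ℕ} {Q : Set Space}
    {d : TwoCopies → Fin k} {x y z : Space}
    (hx : x ∈ properOrbits (doubleGraph c N Q) d) (hy : y ∈ properOrbits (doubleGraph c N Q) d)
    (hxQ : x ∉ Q) (hyQ : y ∉ Q) (hxz : Arrow d x z) (hyz : Arrow d y z) : x = y := by
  by_contra hne
  have h := hx.2 1 false (y, false)
  rw [shift_one] at h
  refine h ((SimpleGraph.fromRel_adj _ _ _).2 ⟨fun h => hne (congrArg Prod.fst h), Or.inl ?_⟩)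
    (hxz.2.trans hyz.2.symm)
  exact Link.clique hxQ hyQ ⟨hne, hx.1, hy.1, z, hxz.1, hyz.1⟩

/-! ### The weights of the arrows -/

lemma measurableSet_potentialArrow (g h : F₂) (b : Bool) :
    MeasurableSet {v : TwoCopies | v.2 = b ∧ PotentialArrow (shift g v.1) (shift h v.1)} := by
  have : {v : TwoCopies | v.2 = b ∧ PotentialArrow (shift g v.1) (shift h v.1)} =
      Prod.snd ⁻¹' {b} ∩ ⋃ i, {v | shift h v.1 = arrowTarget i (shift g v.1)} := by
    ext v
    simp [PotentialArrow, arrowTarget]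
  rw [this]
  refine (measurable_snd (measurableSet_singleton b)).inter (MeasurableSet.iUnion fun i => ?_)
  exact measurableSet_eq_fun (by fun_prop)
    ((measurable_arrowTarget i).comp ((measurable_shift g).comp measurable_fst))

section Weights

variable {k N : ℕ} {𝒜 : Set (Set TwoCopies)} {μ : AddContent ℝ≥0∞ 𝒜} {d : TwoCopies → Fin k}

/-- The sources in the first copy of the arrows along the letter `dir i s`. -/
def outSet (d : TwoCopies → Fin k) (p : Fin 2 × Bool) : Set TwoCopies :=
  {v | v.2 = false ∧ Arrow d v.1 (shift (dir p.1 p.2) v.1)}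

/-- The targets in the second copy of the arrows along the letter `dir i s`. -/
def inSet (d : TwoCopies → Fin k) (p : Fin 2 × Bool) : Set TwoCopies :=
  {v | v.2 = true ∧ Arrow d (shift (dir p.1 p.2)⁻¹ v.1) v.1}

lemma outWeight_eq (μ : Set TwoCopies → ℝ≥0∞) :
    outWeight μ d = 2 * ∑ p, μ (outSet d p) := by
  rw [outWeight, Fintype.sum_prod_type]; rfl

lemma inWeight_eq (μ : Set TwoCopies → ℝ≥0∞) : inWeight μ d = 2 * ∑ p, μ (inSet d p) := by
  rw [inWeight, Fintype.sum_prod_type]; rfl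

/-- The points of a Borel set that have the same colour as a given descendant. -/
lemma inter_colour_eq_desc_mem (hμ : IsFinAddExtension twoCopyMeasure 𝒜 μ)
    (h𝒜 : DescMeasurable (desc N) 𝒜) (hd : ColouringMeasurable 𝒜 d) {E : Set TwoCopies}
    (hE : MeasurableSet E) (g : Move N) : {v | v ∈ E ∧ d v = d (desc N g v)} ∈ 𝒜 := by
  have : {v | v ∈ E ∧ d v = d (desc N g v)} =
      ⋃ a ∈ (Finset.univ : Finset (Fin k)), E ∩ (d ⁻¹' {a} ∩ desc N g ⁻¹' (d ⁻¹' {a})) := by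
    ext v
    simp only [Set.mem_ofPred_eq, Finset.mem_univ, Set.iUnion_true, Set.mem_iUnion,
      Set.mem_inter_iff,
      Set.mem_preimage, Set.mem_singleton_iff]
    exact ⟨fun h => ⟨d v, h.1, rfl, h.2.symm⟩, fun ⟨a, h1, h2, h3⟩ => ⟨h1, h2.trans h3.symm⟩⟩
  rw [this]
  have ha : ∀ a, d ⁻¹' {a} ∈ 𝒜 := fun a => hd _ (measurableSet_singleton a)
  exact hμ.isSetAlgebra.isSetRing.biUnion_mem _ fun a _ =>
    hμ.isSetAlgebra.inter_mem (hμ.mem_of_measurableSet E hE)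
      (hμ.isSetAlgebra.inter_mem (ha a) (h𝒜 g _ (ha a)))

/-- The move given by a letter. -/
def Move.letter (hN : Odd N) (p : Fin 2 × Bool) : Move N :=
  Move.ofOdd (dir p.1 p.2) (by rw [norm_dir]; decide) (by rw [norm_dir]; exact hN.pos)

lemma desc_letter (hN : Odd N) (p : Fin 2 × Bool) (v : TwoCopies) :
    desc N (Move.letter hN p) v = (shift (dir p.1 p.2) v.1, !v.2) :=
  desc_ofOdd _ _ _ _

lemma outSet_mem (hN : Odd N) (hμ : IsFinAddExtension twoCopyMeasure 𝒜 μ)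
    (h𝒜 : DescMeasurable (desc N) 𝒜) (hd : ColouringMeasurable 𝒜 d) (p : Fin 2 × Bool) :
    outSet d p ∈ 𝒜 := by
  have h := inter_colour_eq_desc_mem hμ h𝒜 hd
    (measurableSet_potentialArrow 1 (dir p.1 p.2) false) (Move.letter hN p)
  convert h using 1
  ext ⟨x, b⟩
  simp only [outSet, Arrow, Set.mem_ofPred_eq, shift_one, desc_letter]
  constructor
  · rintro ⟨rfl, h1, h2⟩
    exact ⟨⟨rfl, h1⟩, h2⟩
  · rintro ⟨⟨rfl, h1⟩, h2⟩
    exact ⟨rfl, h1, h2⟩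

lemma inSet_mem (hN : Odd N) (hμ : IsFinAddExtension twoCopyMeasure 𝒜 μ)
    (h𝒜 : DescMeasurable (desc N) 𝒜) (hd : ColouringMeasurable 𝒜 d) (p : Fin 2 × Bool) :
    inSet d p ∈ 𝒜 := by
  have h := inter_colour_eq_desc_mem hμ h𝒜 hd
    (measurableSet_potentialArrow (dir p.1 p.2)⁻¹ 1 true) (Move.letter hN (p.1, !p.2))
  convert h using 1
  ext ⟨x, b⟩
  simp only [inSet, Arrow, Set.mem_ofPred_eq, shift_one, desc_letter, dir_not]
  constructor
  · rintro ⟨rfl, h1, h2⟩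
    exact ⟨⟨rfl, h1⟩, h2.symm⟩
  · rintro ⟨⟨rfl, h1⟩, h2⟩
    exact ⟨rfl, h1, h2.symm⟩

/-- An arrow along a letter is counted at its source or at its target, and the letter is a
descendant that takes the source to the target. -/
lemma outWeight_eq_inWeight (hN : Odd N) (hμ : IsFinAddExtension twoCopyMeasure 𝒜 μ)
    (h𝒜 : DescInvariant (desc N) 𝒜 μ) (hd : ColouringMeasurable 𝒜 d) :
    outWeight μ d = inWeight μ d := by
  rw [outWeight_eq, inWeight_eq]
  congr 1
  refine Finset.sum_congr rfl fun p _ => ?_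
  rw [← h𝒜.2 (Move.letter hN p) _ (inSet_mem hN hμ h𝒜.1 hd p)]
  congr 1
  ext ⟨x, b⟩
  simp only [outSet, inSet, Set.mem_preimage, desc_letter, Set.mem_ofPred_eq, shift_inv_shift]
  simp

lemma measure_snd_eq (b : Bool) {E : Set Space} :
    twoCopyMeasure {v | v.2 = b ∧ v.1 ∈ E} = productProb E * 2⁻¹ := by
  rw [← twoCopyMeasure_prod E b]
  congr 1
  ext v
  exact and_comm

lemma measurableSet_snd_eq (b : Bool) {E : Set Space} (hE : MeasurableSet E) :
    MeasurableSet {v : TwoCopies | v.2 = b ∧ v.1 ∈ E} :=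
  (measurable_snd (measurableSet_singleton b)).inter (measurable_fst hE)

lemma le_outWeight {c : Space → Fin k} {Q : Set Space} (hN : Odd N) (hQ : MeasurableSet Q)
    (hQm : productProb Q < 1 / 512) (hcQ : ColoursAppear c N Q)
    (hμ : IsFinAddExtension twoCopyMeasure 𝒜 μ) (h𝒜 : DescMeasurable (desc N) 𝒜)
    (hsat : Satisfies twoCopyMeasure (desc N) (properRule (doubleGraph c N Q) (desc N)) d)
    (hd : ColouringMeasurable 𝒜 d) : 1 - 1 / 512 ≤ outWeight μ d := by
  have hring := hμ.isSetAlgebra.isSetRing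
  obtain ⟨Z, hZ, hZm, hZ0⟩ := exists_measurable_superset_of_null
    (ae_iff.1 (ae_mem_properOrbits hsat))
  let E : Set TwoCopies := {v | v.2 = false ∧ v.1 ∈ (Q ∪ Z)ᶜ}
  have hE : MeasurableSet E := measurableSet_snd_eq false (hQ.union hZm).compl
  have hQZ : productProb (Q ∪ Z) ≤ 1 / 512 :=
    (measure_union_le _ _).trans (by rw [hZ0, add_zero]; exact hQm.le)
  have hsub : E ⊆ ⋃ p ∈ (Finset.univ : Finset (Fin 2 × Bool)), outSet d p := by
    rintro ⟨x, b⟩ ⟨rfl, hx⟩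
    have hxQ : x ∉ Q := fun h => hx (Or.inl h)
    have hxG : x ∈ properOrbits (doubleGraph c N Q) d := by
      by_contra h
      exact hx (Or.inr (hZ h))
    obtain ⟨i, hi⟩ := exists_arrow hN hcQ hxG hxQ
    simp only [Finset.mem_univ, Set.iUnion_true, Set.mem_iUnion]
    exact ⟨(i, x 1), rfl, ⟨i, rfl⟩, hi⟩
  have hmem : ∀ p ∈ (Finset.univ : Finset (Fin 2 × Bool)), outSet d p ∈ 𝒜 := fun p _ =>
    outSet_mem hN hμ h𝒜 hd p
  have hle : μ E ≤ ∑ p, μ (outSet d p) :=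
    (addContent_mono hring.isSetSemiring (hμ.mem_of_measurableSet E hE)
      (hring.biUnion_mem _ hmem) hsub).trans (addContent_biUnion_le hring hmem)
  rw [outWeight_eq]
  calc 1 - 1 / 512 ≤ productProb (Q ∪ Z)ᶜ := by
        rw [prob_compl_eq_one_sub (hQ.union hZm)]
        exact tsub_le_tsub_left hQZ 1
    _ = 2 * μ E := by
        rw [hμ.eq_of_measurableSet E hE, measure_snd_eq, mul_comm, mul_assoc,
          ENNReal.inv_mul_cancel (by simp) (by simp), mul_one]
    _ ≤ _ := by gcongr

/-- The points to which some arrow could be directed: the coordinate `dir i s` of a point is the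
coordinate at the identity of the possible source along `dir i s`. -/
def possibleTargets : Set Space := {z | ∃ i s, z (dir i s) = s}

lemma measurableSet_possibleTargets : MeasurableSet possibleTargets := by
  have : possibleTargets = ⋃ i, ⋃ s, {z : Space | z (dir i s) = s} := by
    ext z; simp [possibleTargets]
  rw [this]
  exact MeasurableSet.iUnion fun i => MeasurableSet.iUnion fun s =>
    measurableSet_eq_fun (measurable_pi_apply _) measurable_const

lemma productProb_possibleTargets : productProb possibleTargets = 15 / 16 := by
  let S : Finset F₂ := Finset.univ.image fun p : Fin 2 × Bool => dir p.1 p.2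
  have hcompl : possibleTargetsᶜ =
      {z : Space | ∀ h ∈ S, z h = decide (h = dir 0 false ∨ h = dir 1 false)} := by
    have hval : ∀ (i : Fin 2) (s : Bool),
        decide (dir i s = dir 0 false ∨ dir i s = dir 1 false) = !s := by decide
    ext z
    simp only [possibleTargets, Set.mem_compl_iff, Set.mem_ofPred_eq, not_exists, S,
      Finset.mem_image, Finset.mem_univ, true_and, Prod.exists, forall_exists_index]
    constructor
    · rintro h _ i s rfl
      rw [hval]
      exact Bool.eq_not_of_ne (h i s)
    · intro h i s e
      have := h _ i s rfl
      rw [hval, e] at this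
      cases s <;> simp at this
  have hS : S.card = 4 := by decide
  have h1 : productProb possibleTargetsᶜ = 2⁻¹ ^ 4 := by
    rw [hcompl, productProb_cylinder, hS]
  have h2 : productProb possibleTargets = 1 - 2⁻¹ ^ 4 := by
    rw [← h1, prob_compl_eq_one_sub measurableSet_possibleTargets,
      ENNReal.sub_sub_cancel ENNReal.one_ne_top prob_le_one]
  rw [h2, ← ENNReal.toReal_eq_toReal_iff' (by simp) (ENNReal.div_ne_top (by simp) (by simp)),
    ENNReal.toReal_sub_of_le (by rw [← ENNReal.inv_pow]; simp; norm_num) (by simp)]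
  norm_num

lemma inWeight_le {c : Space → Fin k} {Q : Set Space} (hN : Odd N) (hQ : MeasurableSet Q)
    (hQm : productProb Q < 1 / 512)
    (hμ : IsFinAddExtension twoCopyMeasure 𝒜 μ) (h𝒜 : DescMeasurable (desc N) 𝒜)
    (hsat : Satisfies twoCopyMeasure (desc N) (properRule (doubleGraph c N Q) (desc N)) d)
    (hd : ColouringMeasurable 𝒜 d) : inWeight μ d ≤ 31 / 32 := by
  have hring := hμ.isSetAlgebra.isSetRing
  obtain ⟨Z, hZ, hZm, hZ0⟩ := exists_measurable_superset_of_null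
    (ae_iff.1 (ae_mem_properOrbits hsat))
  have hQZm : MeasurableSet (Q ∪ Z) := hQ.union hZm
  have hQZ : productProb (Q ∪ Z) ≤ 1 / 512 :=
    (measure_union_le _ _).trans (by rw [hZ0, add_zero]; exact hQm.le)
  have hgood : ∀ x ∉ Q ∪ Z, x ∈ properOrbits (doubleGraph c N Q) d := fun x hx => by
    by_contra h
    exact hx (Or.inr (hZ h))
  -- The exceptional targets along the letter `p`: the source lies in `Q` or in the null set `Z`.
  let B : Fin 2 × Bool → Set TwoCopies := fun p =>
    {v | v.2 = true ∧ v.1 ∈ shift (dir p.1 p.2)⁻¹ ⁻¹' (Q ∪ Z)}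
  have hB : ∀ p, MeasurableSet (B p) := fun p =>
    measurableSet_snd_eq true (measurable_shift _ hQZm)
  have hBm : ∀ p, μ (B p) ≤ 1 / 1024 := by
    intro p
    rw [hμ.eq_of_measurableSet _ (hB p), measure_snd_eq,
      (measurePreserving_shift _).measure_preimage hQZm.nullMeasurableSet]
    calc productProb (Q ∪ Z) * 2⁻¹ ≤ 1 / 512 * 2⁻¹ := by gcongr
      _ = 1 / 1024 := by
        rw [one_div, one_div, ← ENNReal.mul_inv (by simp) (by simp)]
        norm_num
  have hin : ∀ p, inSet d p ∈ 𝒜 := inSet_mem hN hμ h𝒜 hd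
  have hBA : ∀ p, B p ∈ 𝒜 := fun p => hμ.mem_of_measurableSet _ (hB p)
  let R : Fin 2 × Bool → Set TwoCopies := fun p => inSet d p \ B p
  have hR : ∀ p ∈ (Finset.univ : Finset (Fin 2 × Bool)), R p ∈ 𝒜 := fun p _ =>
    hring.sdiff_mem (hin p) (hBA p)
  have hsource : ∀ (p : Fin 2 × Bool) (v : TwoCopies), v ∈ R p →
      shift (dir p.1 p.2)⁻¹ v.1 ∉ Q ∪ Z := fun p v hv h => hv.2 ⟨hv.1.1, h⟩
  have hdisj : Set.PairwiseDisjoint ((Finset.univ : Finset (Fin 2 × Bool)) : Set (Fin 2 × Bool))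
      R := by
    intro p _ q _ hpq
    rw [Function.onFun, Set.disjoint_left]
    intro v hp hq
    have h1 := hsource p v hp
    have h2 := hsource q v hq
    have heq := arrow_source_unique (hgood _ h1) (hgood _ h2) (fun h => h1 (Or.inl h))
      (fun h => h2 (Or.inl h)) hp.1.2 hq.1.2
    rw [shift_inj_of_mem_freePart ((shift_mem_freePart_iff _).1 (hgood _ h1).1), inv_inj] at heq
    exact hpq (Prod.ext (dir_injective heq).1 (dir_injective heq).2)
  let W : Set TwoCopies := {v | v.2 = true ∧ v.1 ∈ possibleTargets}
  have hW : MeasurableSet W := measurableSet_snd_eq true measurableSet_possibleTargets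
  have hRW : ⋃ p ∈ (Finset.univ : Finset (Fin 2 × Bool)), R p ⊆ W := by
    refine Set.iUnion₂_subset fun p _ v hv => ⟨hv.1.1, p.1, p.2, ?_⟩
    have hfree := (hgood _ (hsource p v hv)).1
    have harrow := hv.1.2.1
    have := (potentialArrow_shift_dir_iff hfree p.1 p.2).1 (by rwa [shift_shift_inv])
    rwa [shift_apply_one, inv_inv] at this
  have hsum : ∑ p, μ (R p) ≤ 15 / 32 := by
    rw [← addContent_biUnion hR hdisj (hring.biUnion_mem _ hR)]
    refine (addContent_mono hring.isSetSemiring (hring.biUnion_mem _ hR)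
      (hμ.mem_of_measurableSet W hW) hRW).trans_eq ?_
    rw [hμ.eq_of_measurableSet W hW, measure_snd_eq, productProb_possibleTargets, div_eq_mul_inv,
      mul_assoc, ← ENNReal.mul_inv (by simp) (by simp), div_eq_mul_inv]
    norm_num
  have hle : ∀ p, μ (inSet d p) ≤ μ (R p) + μ (B p) := by
    intro p
    refine (addContent_mono hring.isSetSemiring (hin p)
      (hring.union_mem (hR p (Finset.mem_univ p)) (hBA p)) ?_).trans
      (addContent_union_le hring (hR p (Finset.mem_univ p)) (hBA p))
    rw [Set.sdiff_union_self]
    exact Set.subset_union_left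
  rw [inWeight_eq]
  calc 2 * ∑ p, μ (inSet d p) ≤ 2 * (15 / 32 + ∑ _p : Fin 2 × Bool, 1 / 1024) := by
        gcongr
        refine (Finset.sum_le_sum fun p _ => hle p).trans ?_
        rw [Finset.sum_add_distrib]
        exact add_le_add hsum (Finset.sum_le_sum fun p _ => hBm p)
    _ ≤ 31 / 32 := by
        have h1 : (15 / 32 : ℝ≥0∞) ≠ ∞ := by simp [ENNReal.div_eq_top]
        have h2 : ∑ _p : Fin 2 × Bool, (1 / 1024 : ℝ≥0∞) ≠ ∞ := by simp [ENNReal.mul_eq_top]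
        rw [← ENNReal.toReal_le_toReal (by finiteness) (by simp [ENNReal.div_eq_top]),
          ENNReal.toReal_mul, ENNReal.toReal_add h1 h2]
        simp
        norm_num

end Weights

/-- For an invariant finitely additive measure the outgoing and the incoming arrows would have the
same weight, contrary to the bounds for the two weights. -/
lemma isParadoxical_properRule {k : ℕ} {c : Space → Fin k} (hc : IsOriginalColouring k c) {N : ℕ}
    (hN : Odd N) {Q : Set Space} (hQ : MeasurableSet Q) (hQm : productProb Q < 1 / 512)
    (hcQ : ColoursAppear c N Q) :
    IsParadoxical twoCopyMeasure (desc N)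
      (properRule (A := Fin k) (doubleGraph c N Q) (desc N)) where
  isColouringRule := isColouringRule_properRule hc.measurable N hQ
  nonContradictory := by
    obtain ⟨e, he⟩ := hc.exists_isListColouring
    exact ⟨fun v => if v.2 then c v.1 else e v.1,
      Filter.Eventually.of_forall fun v i hi => he.ne_of_adj hi⟩
  not_measurable := by
    intro 𝒜 μ hμ h𝒜 d hsat hd
    have h1 := le_outWeight hN hQ hQm hcQ hμ h𝒜.1 hsat hd
    rw [outWeight_eq_inWeight hN hμ h𝒜 hd] at h1
    have h2 := h1.trans (inWeight_le hN hQ hQm hμ h𝒜.1 hsat hd)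
    rw [← ENNReal.toReal_le_toReal (by simp) (by simp [ENNReal.div_eq_top]),
      ENNReal.toReal_sub_of_le (by simp) (by simp)] at h2
    norm_num at h2

end ParadoxicalColouring

open ParadoxicalColouring in
theorem mainTheorem5 :
    (∃ k ≤ 17, ∃ c : Space → Fin k, IsOriginalColouring k c) ∧
    ∀ (k : ℕ) (c : Space → Fin k), IsOriginalColouring k c →
      (∀ ε : ℝ≥0∞, 0 < ε → ∃ (N : ℕ) (Q : Set Space),
        Odd N ∧ MeasurableSet Q ∧ productProb Q ≤ ε ∧ ColoursAppear c N Q) ∧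
      ∀ (N : ℕ) (Q : Set Space),
        Odd N → MeasurableSet Q → productProb Q < 1 / 512 → ColoursAppear c N Q →
        -- the graph has finite degree, and all neighbours are descendants
        (∃ D : ℕ, ∀ v, ((doubleGraph c N Q).neighborSet v).encard ≤ D) ∧
        (∀ v w, (doubleGraph c N Q).Adj v w → ∃ g, desc N g v = w) ∧
        -- the relevance of each descendant is a Borel condition
        (∀ g, MeasurableSet {v | (doubleGraph c N Q).Adj v (desc N g v)}) ∧
        ¬ IsStationary twoCopyMeasure
          (properRule (A := Fin k) (doubleGraph c N Q) (desc N)) ∧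
        IsParadoxical twoCopyMeasure (desc N)
          (properRule (A := Fin k) (doubleGraph c N Q) (desc N)) ∧
        -- the outgoing and the incoming weight of the arrows
        (∀ (𝒜 : Set (Set TwoCopies)) (μ : AddContent ℝ≥0∞ 𝒜),
          IsFinAddExtension twoCopyMeasure 𝒜 μ → DescMeasurable (desc N) 𝒜 →
          ∀ d : TwoCopies → Fin k,
            Satisfies twoCopyMeasure (desc N) (properRule (doubleGraph c N Q) (desc N)) d →
            ColouringMeasurable 𝒜 d →
            1 - 1 / 512 ≤ outWeight μ d ∧ inWeight μ d ≤ 31 / 32 ∧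
              (DescInvariant (desc N) 𝒜 μ → outWeight μ d = inWeight μ d)) ∧
        -- proper colourings from the original colouring and proper list colourings
        (∃ e : Space → Fin k, IsListColouring c e) ∧
        ∀ e : Space → Fin k, IsListColouring c e →
          ∀ v w, (doubleGraph c N Q).Adj v w →
            (if v.2 then c v.1 else e v.1) ≠ (if w.2 then c w.1 else e w.1) := by
  refine ⟨⟨17, le_rfl, exists_isOriginalColouring⟩, fun k c hc =>
    ⟨fun ε hε => hc.exists_coloursAppear hε, fun N Q hN hQ hQm hcQ => ?_⟩⟩
  refine ⟨⟨Nat.card (Move N), encard_neighborSet_le c N Q⟩, fun v w h => exists_desc_of_adj h,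
    measurableSet_adj_desc hc.measurable N hQ, not_isStationary hc N hQ hQm,
    isParadoxical_properRule hc hN hQ hQm hcQ, fun 𝒜 μ hμ h𝒜 d hsat hd => ?_,
    hc.exists_isListColouring, fun e he v w h => he.ne_of_adj h⟩
  exact ⟨le_outWeight hN hQ hQm hcQ hμ h𝒜 hsat hd, inWeight_le hN hQ hQm hμ h𝒜 hsat hd,
    fun hinv => outWeight_eq_inWeight hN hμ hinv hd⟩
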